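/- For non-zero integers $k_1,\dots,k_u$ let $P(k_1,\dots,k_u)$ be the standard pretzel link diagram: $u$ pairs of parallel vertical strands, the $i$-th pair with $|k_i|$ half-twists (right-handed if $k_i>0$, left-handed if $k_i<0$; a right-handed half-twist is a positive crossing when its two strands are oriented in parallel), where neighbouring pairs $i$ and $i+1$ (indices mod $u$) are joined by a top bridge $t_i$ and a bottom bridge $b_i$. An enhanced pretzel sequence $\hat{\varepsilon}=(k_1\varepsilon_1,\dots,k_u\varepsilon_u)$ carries in addition labels $\varepsilon_i\in\{\text{antiparallel},\text{parallel}\}$, and is such that the diagram admits an orientation for which, for every $i$, the two strands of the $i$-th pair are antiparallel or parallel according to $\varepsilon_i$. $P_{\hat{\varepsilon}}$ denotes the diagram $P(k_1,\dots,k_u)$ with the orientation of this kind for which $t_1$ is directed from the first pair to the second. A sequence $(k_1,\dots,k_{2v})$, $v\ge 1$, of non-zero integers is erasable if either $v=1$ and $k_1+k_2=0$, or $v\ge 2$ and there are $i<j$ with $k_i+k_j=0$ such that the sequence obtained by deleting $k_i$ and $k_j$ is erasable. A pairing permutation for it is a permutation $\sigma$ of $\{1,\dots,2v\}$ that is a composition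 of $v$ mutually disjoint transpositions and satisfies $k_i+k_{\sigma(i)}=0$ for all $i$. The Conway polynomial $\nabla_L(z)\in\mathbb{Z}[z]$ of oriented links $L$ is the isotopy invariant determined by $\nabla_{\text{unknot}}(z)=1$ and $\nabla_{L_+}(z)-\nabla_{L_-}(z)=z\,\nabla_{L_0}(z)$ for every skein triple $(L_+,L_-,L_0)$. Proposition. Let $\hat{\varepsilon}=(k_1\varepsilon_1,\dots,k_{2v}\varepsilon_{2v})$ be an enhanced pretzel sequence such that $(k_1,\dots,k_{2v})$ is erasable and $|k_i|\ge 2$ for $i=1,\dots,2v$. If a pairing permutation $\sigma$ for $(k_1,\dots,k_{2v})$ satisfies $\varepsilon_{\sigma(i)}=\varepsilon_i$ for each $i=1,\dots,2v$, then $\nabla_{P_{\hat{\varepsilon}}}(z)=0$. -/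

import Mathlib

open Polynomial

namespace PretzelConway

/-! ## Oriented link diagrams

A link diagram in the plane, put in general position with respect to the height function, is read
from top to bottom as a word of elementary pieces: local maxima, local minima and crossings.  At
each generic height the diagram meets the horizontal line in finitely many points, numbered
`0, 1, 2, …` from left to right; the orientation of the diagram there is recorded as a list of
booleans, `true` for a strand directed downwards and `false` for a strand directed upwards. -/

/-- Elementary pieces of an oriented link diagram.
* `birth d`: a local maximum, whose left leg has direction `d` (and the right leg direction `!d`).
* `death`: a local minimum, joining two neighbouring strands.
* `cross s`: a crossing of two neighbouring strands; for `s = true` the over-strand is the one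
  that joins top right to bottom left, for `s = false` the one that joins top left to bottom
  right.  So `cross true` is a positive crossing when both strands point downwards or both point
  upwards, and a negative one otherwise. -/
inductive Piece where
  | birth (d : Bool)
  | death
  | cross (s : Bool)

/-- The number of strands that a piece meets at its top. -/
def Piece.inn : Piece → ℕ
  | .birth _ => 0
  | .death => 2
  | .cross _ => 2

/-- The number of strands that a piece meets at its bottom. -/
def Piece.out : Piece → ℕ
  | .birth _ => 2
  | .death => 0
  | .cross _ => 2

/-- The effect of a piece, placed at the left end, on the list of strand directions.  The result
is `none` if strands are missing or if the orientations do not match. -/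
def Piece.apply : Piece → List Bool → Option (List Bool)
  | .birth d, l => some (d :: (!d) :: l)
  | .death, a :: b :: l => if a = b then none else some l
  | .cross _, a :: b :: l => some (b :: a :: l)
  | _, _ => none

/-- The effect of a piece that is placed to the right of the first `i` strands. -/
def applyAt : ℕ → Piece → List Bool → Option (List Bool)
  | 0, g, l => g.apply l
  | i + 1, g, a :: l => (applyAt i g l).map (a :: ·)
  | _ + 1, _, [] => none

/-- A word of pieces, from top to bottom; `(i, g)` is the piece `g` with exactly `i` strands
passing to its left. -/
abbrev Word := List (ℕ × Piece)

/-- The list of strand directions below a word that starts with no strands at all. -/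
def Word.run (w : Word) : Option (List Bool) :=
  w.foldlM (fun l p => applyAt p.1 p.2 l) []

/-- The word is a diagram of an oriented link: it starts and ends with no strands, and all
orientations match. -/
def Word.IsLinkDiagram (w : Word) : Prop := w.run = some []

/-! ## Isotopy -/

/-- The local moves between diagrams in general position: planar isotopies and Reidemeister
moves. -/
inductive LocalMove : Word → Word → Prop
  /-- Pieces that lie side by side may change their heights. -/
  | exchange (i k : ℕ) (g h : Piece) :
      LocalMove [(i, g), (i + g.out + k, h)] [(i + g.inn + k, h), (i, g)]
  /-- A maximum and a minimum on the same strand cancel. -/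
  | zigzagLeft (i : ℕ) (d : Bool) :
      LocalMove [(i, .birth d), (i + 1, .death)] []
  | zigzagRight (i : ℕ) (d : Bool) :
      LocalMove [(i + 1, .birth d), (i, .death)] []
  /-- A strand that crosses one leg of a minimum or of a maximum slides to the other leg. -/
  | slideDeath (i : ℕ) (s : Bool) :
      LocalMove [(i, .cross s), (i + 1, .death)] [(i + 1, .cross (!s)), (i, .death)]
  | slideBirth (i : ℕ) (d s : Bool) :
      LocalMove [(i + 1, .birth d), (i, .cross s)] [(i, .birth d), (i + 1, .cross (!s))]
  /-- The first Reidemeister move, at a minimum and at a maximum. -/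
  | reidemeisterOneDeath (i : ℕ) (s : Bool) :
      LocalMove [(i, .cross s), (i, .death)] [(i, .death)]
  | reidemeisterOneBirth (i : ℕ) (d s : Bool) :
      LocalMove [(i, .birth d), (i, .cross s)] [(i, .birth (!d))]
  /-- The second Reidemeister move. -/
  | reidemeisterTwo (i : ℕ) (s : Bool) :
      LocalMove [(i, .cross s), (i, .cross (!s))] []
  /-- The third Reidemeister move. -/
  | reidemeisterThree (i : ℕ) (s : Bool) :
      LocalMove [(i, .cross s), (i + 1, .cross s), (i, .cross s)]
        [(i + 1, .cross s), (i, .cross s), (i + 1, .cross s)]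

/-- One local move, applied inside an oriented link diagram. -/
inductive Move : Word → Word → Prop
  | mk (A B l l' : Word) (h : LocalMove l l')
      (hD : Word.IsLinkDiagram (A ++ l ++ B)) (hD' : Word.IsLinkDiagram (A ++ l' ++ B)) :
      Move (A ++ l ++ B) (A ++ l' ++ B)

/-- Two diagrams represent the same oriented link: they are joined by a finite sequence of local
moves and their inverses through oriented link diagrams. -/
def Isotopic : Word → Word → Prop := Relation.EqvGen Move

/-! ## The Conway polynomial -/

/-- `SkeinTriple D₊ D₋ D₀`: three oriented link diagrams that are identical outside a disk, in
which they are a positive crossing, a negative crossing, and the smoothing that respects the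
orientation. -/
inductive SkeinTriple : Word → Word → Word → Prop
  /-- The two strands at the crossing point both downwards or both upwards: the smoothing
  consists of two vertical strands. -/
  | parallel (A B : Word) (L R : List Bool) (b : Bool)
      (hA : A.run = some (L ++ b :: b :: R))
      (hp : Word.IsLinkDiagram (A ++ [(L.length, .cross true)] ++ B))
      (hm : Word.IsLinkDiagram (A ++ [(L.length, .cross false)] ++ B))
      (h0 : Word.IsLinkDiagram (A ++ B)) :
      SkeinTriple (A ++ [(L.length, .cross true)] ++ B) (A ++ [(L.length, .cross false)] ++ B)
        (A ++ B)
  /-- One of the two strands at the crossing points downwards and the other upwards: the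
  smoothing consists of a minimum above a maximum. -/
  | antiparallel (A B : Word) (L R : List Bool) (b : Bool)
      (hA : A.run = some (L ++ b :: (!b) :: R))
      (hp : Word.IsLinkDiagram (A ++ [(L.length, .cross false)] ++ B))
      (hm : Word.IsLinkDiagram (A ++ [(L.length, .cross true)] ++ B))
      (h0 : Word.IsLinkDiagram (A ++ [(L.length, .death), (L.length, .birth (!b))] ++ B)) :
      SkeinTriple (A ++ [(L.length, .cross false)] ++ B) (A ++ [(L.length, .cross true)] ++ B)
        (A ++ [(L.length, .death), (L.length, .birth (!b))] ++ B)

/-- The round circle without crossings. -/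
def unknot : Word := [(0, .birth true), (0, .death)]

/-- `HasConwayPolynomial D p`: the Conway polynomial `∇_D(z)` of the oriented link with diagram
`D` is `p` (the variable `X` of `ℤ[X]` is `z`).  The Conway polynomial is determined by the axioms
that it is an invariant of oriented links, that it is `1` for the unknot, and that
`∇(D₊) - ∇(D₋) = z ∇(D₀)`; accordingly its graph is the smallest relation between diagrams and
polynomials that is closed under these axioms, where the skein relation may be used to find any
one of its three terms from the two others. -/
inductive HasConwayPolynomial : Word → ℤ[X] → Prop
  | unknot : HasConwayPolynomial unknot 1
  | isotopic {D D' : Word} {p : ℤ[X]} (h : Isotopic D D') (hD : HasConwayPolynomial D p) :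
      HasConwayPolynomial D' p
  | skein_pos {Dp Dm D0 : Word} {q r : ℤ[X]} (h : SkeinTriple Dp Dm D0)
      (hm : HasConwayPolynomial Dm q) (h0 : HasConwayPolynomial D0 r) :
      HasConwayPolynomial Dp (q + X * r)
  | skein_neg {Dp Dm D0 : Word} {p r : ℤ[X]} (h : SkeinTriple Dp Dm D0)
      (hp : HasConwayPolynomial Dp p) (h0 : HasConwayPolynomial D0 r) :
      HasConwayPolynomial Dm (p - X * r)
  | skein_zero {Dp Dm D0 : Word} {q r : ℤ[X]} (h : SkeinTriple Dp Dm D0)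
      (hp : HasConwayPolynomial Dp (q + X * r)) (hm : HasConwayPolynomial Dm q) :
      HasConwayPolynomial D0 r

/-- Every function on diagrams that satisfies the axioms of the Conway polynomial takes the value
`p` at `D` as soon as `HasConwayPolynomial D p` holds. -/
theorem HasConwayPolynomial.eq_of_axioms {nabla : Word → ℤ[X]}
    (hunknot : nabla PretzelConway.unknot = 1)
    (hisotopic : ∀ D D', Isotopic D D' → nabla D = nabla D')
    (hskein : ∀ Dp Dm D0, SkeinTriple Dp Dm D0 → nabla Dp - nabla Dm = X * nabla D0)
    {D : Word} {p : ℤ[X]} (h : HasConwayPolynomial D p) : nabla D = p := by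
  induction h with
  | unknot => exact hunknot
  | isotopic h _ ih => rw [← hisotopic _ _ h, ih]
  | skein_pos h _ _ ihm ih0 =>
    have := hskein _ _ _ h
    rw [ihm, ih0] at this
    linear_combination this
  | skein_neg h _ _ ihp ih0 =>
    have := hskein _ _ _ h
    rw [ihp, ih0] at this
    linear_combination -this
  | skein_zero h _ _ ihp ihm =>
    have := hskein _ _ _ h
    rw [ihp, ihm, add_sub_cancel_left] at this
    exact (mul_left_cancel₀ X_ne_zero this).symm

/-! ## Pretzel diagrams -/

/-- The label of a pair of parallel strands in an oriented pretzel diagram. -/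
inductive StrandLabel where
  | antiparallel
  | parallel

/-- The standard pretzel diagram `P(k₁, …, k_u)`, `u ≥ 1`, with oriented top bridges.  Column `i`
(`0 ≤ i < u`) consists of the strands `2 * i` and `2 * i + 1`, with `|kᵢ|` crossings, right-handed
half-twists (`cross true`) if `kᵢ > 0` and left-handed ones if `kᵢ < 0`.  The top bridge `i`
joins the top right end of column `i` to the top left end of column `i + 1`; the top bridge `u - 1`
joins column `u - 1` to column `0` and passes above all others.  The bottom bridges are placed in
the same way.  `t i = true` means that the top bridge `i` is positive: it is directed from
column `i` to the (cyclically) next column. -/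
def pretzelWord (k : List ℤ) (t : ℕ → Bool) : Word :=
  (0, .birth (t (k.length - 1))) ::
    ((List.range (k.length - 1)).map fun i => (2 * i + 1, Piece.birth (!t i))) ++
    (k.mapIdx fun i m => List.replicate m.natAbs (2 * i, Piece.cross (decide (0 < m)))).flatten ++
    ((List.range (k.length - 1)).reverse.map fun i => (2 * i + 1, Piece.death)) ++
    [(0, .death)]

/-- The direction of the left strand of column `i`, at its top: downwards if the top bridge that
ends there is positive. -/
def leftDirection (u : ℕ) (t : ℕ → Bool) (i : ℕ) : Bool := t ((i + u - 1) % u)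

/-- The direction of the right strand of column `i`, at its top: upwards if the top bridge that
starts there is positive. -/
def rightDirection (t : ℕ → Bool) (i : ℕ) : Bool := !t i

/-- `D` is the oriented pretzel diagram `P(k₁ε₁, …, k_uε_u)`, with `u ≥ 1`: it is the pretzel
diagram `P(k₁, …, k_u)` of the non-zero integers `kᵢ` with an orientation for which the first top
bridge is positive and the two strands of each column are antiparallel or parallel as its label
says.  (Columns are numbered from `0`.)  For some labels there is no such diagram. -/
def IsOrientedPretzel {u : ℕ} (k : Fin u → ℤ) (ε : Fin u → StrandLabel) (D : Word) : Prop :=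
  0 < u ∧ (∀ i, k i ≠ 0) ∧
  ∃ t : ℕ → Bool,
    D = pretzelWord (List.ofFn k) t ∧ D.IsLinkDiagram ∧ t 0 = true ∧
    ∀ i : Fin u, ε i = .antiparallel ↔ leftDirection u t i ≠ rightDirection t i

/-- Erasable sequences of non-zero integers. -/
inductive Erasable : List ℤ → Prop
  | pair (a b : ℤ) (ha : a ≠ 0) (h : a + b = 0) : Erasable [a, b]
  | step (l : List ℤ) (i j : Fin l.length) (hij : i < j) (hi : l[i] ≠ 0) (h : l[i] + l[j] = 0)
      (hl : Erasable ((l.eraseIdx j).eraseIdx i)) : Erasable l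

/-- A pairing permutation for `(k₁, …, k_{2v})`: a product of `v` disjoint transpositions, i.e. an
involution without fixed points, with `kᵢ + k_{σ(i)} = 0` for all `i`. -/
def IsPairingPermutation {v : ℕ} (k : Fin (2 * v) → ℤ) (σ : Equiv.Perm (Fin (2 * v))) : Prop :=
  (∀ i, σ (σ i) = i) ∧ (∀ i, σ i ≠ i) ∧ ∀ i, k i + k (σ i) = 0

end PretzelConway

/-!
A pretzel diagram is read as a sequence of columns, each attached to a tangle with four lower ends
that contains the columns on its left (`column`, `exists_isotopic_sideArcs`,
`pretzelTail_cons_cons`).  In every completion, such a tangle is a combination, with coefficients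
in `ℤ[X]`, of two elementary tangles (`Expands`).  The skein relation, applied to the crossings of
a column (`HasConwayPolynomial.twists_parallel`, `HasConwayPolynomial.twists_antiparallel`), says
how the two coefficients change when the column is attached.  The orientations leave two cases.

* No column of antiparallel strands has an odd number of crossings.  The coefficients `p` and `q`
  are encoded by the dual number `p + (2 * q) ε`, `ε ^ 2 = 0`, with a correction term after an odd
  number of columns of parallel strands (`MixedInvariant`), and each column multiplies it by
  `-(a / 2) * X + 2 ε` for `a` half-twists of antiparallel strands, and by `F + L ε` for `a`
  half-twists of parallel strands, where `F` and `L` are the `a`-th Fibonacci and Lucas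
  polynomials.  The factors for `a` and `-a` have a product without `ε`.
* All columns consist of antiparallel strands and have odd numbers of crossings.  Then each column
  multiplies `p + q ω`, where `ω ^ 2 = 1 - X * ω`, by `ω - ⌊a / 2⌋ * X`, and the factors for `a`
  and `-a` have a product without `ω`, since it is the norm of one of them up to sign.

In both cases the Conway polynomial of the diagram is the coefficient `q` at the end.  As the ring
of coefficients is commutative, the positions of paired columns do not matter
(`prod_mem_of_involution`), and the coefficient `q` vanishes.
-/

namespace PretzelConway

/-! ### Strand directions along a word -/

/-- The strand directions below the word `w`, if those above it are `s`. -/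
def runFrom (s : List Bool) (w : Word) : Option (List Bool) :=
  w.foldlM (fun l p => applyAt p.1 p.2 l) s

theorem run_eq_runFrom (w : Word) : w.run = runFrom [] w := rfl

@[simp] theorem runFrom_nil (s : List Bool) : runFrom s [] = some s := rfl

theorem runFrom_cons (s : List Bool) (p : ℕ × Piece) (w : Word) :
    runFrom s (p :: w) = (applyAt p.1 p.2 s).bind (runFrom · w) := by
  simp only [runFrom, List.foldlM_cons]
  rfl

theorem runFrom_append (s : List Bool) (w w' : Word) :
    runFrom s (w ++ w') = (runFrom s w).bind (runFrom · w') := by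
  simp only [runFrom, List.foldlM_append]
  rfl

theorem run_append (A w : Word) : Word.run (A ++ w) = A.run.bind (runFrom · w) :=
  runFrom_append [] A w

theorem run_append_of_run {A : Word} {s : List Bool} (hA : A.run = some s) (w : Word) :
    Word.run (A ++ w) = runFrom s w := by
  rw [run_append, hA, Option.bind_some]

theorem applyAt_append (g : Piece) (L R : List Bool) :
    applyAt L.length g (L ++ R) = (g.apply R).map (L ++ ·) := by
  induction L with
  | nil => simp [applyAt]
  | cons a L ih =>
    simp only [List.length_cons, List.cons_append, applyAt, ih, Option.map_map]
    rfl

theorem applyAt_comm (i k : ℕ) (g h : Piece) (s : List Bool) :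
    (applyAt i g s).bind (applyAt (i + g.out + k) h) =
      (applyAt (i + g.inn + k) h s).bind (applyAt i g) := by
  induction i generalizing s with
  | zero =>
    cases g with
    | birth d =>
      have e : 0 + (Piece.birth d).out + k = k + 1 + 1 := by simp [Piece.out]; omega
      have e' : 0 + (Piece.birth d).inn + k = k := by simp [Piece.inn]
      rw [e, e']
      simp only [applyAt, Piece.apply, Option.bind_some, Option.map_map]
      cases applyAt k h s <;> rfl
    | death =>
      have e : 0 + Piece.death.out + k = k := by simp [Piece.out]
      have e' : 0 + Piece.death.inn + k = k + 1 + 1 := by simp [Piece.inn]; omega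
      rw [e, e']
      rcases s with _ | ⟨a, _ | ⟨b, l⟩⟩
      · rfl
      · rfl
      · simp only [applyAt, Piece.apply, Option.map_map]
        by_cases hab : a = b
        · cases applyAt k h l <;> simp [hab]
        · simp only [hab, if_false, Option.bind_some]
          cases applyAt k h l <;> simp [hab]
    | cross t =>
      have e : 0 + (Piece.cross t).out + k = k + 1 + 1 := by simp [Piece.out]; omega
      have e' : 0 + (Piece.cross t).inn + k = k + 1 + 1 := by simp [Piece.inn]; omega
      rw [e, e']
      rcases s with _ | ⟨a, _ | ⟨b, l⟩⟩
      · rfl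
      · rfl
      · simp only [applyAt, Piece.apply, Option.bind_some, Option.map_map]
        cases applyAt k h l <;> rfl
  | succ i ih =>
    have e : i + 1 + g.out + k = (i + g.out + k) + 1 := by omega
    have e' : i + 1 + g.inn + k = (i + g.inn + k) + 1 := by omega
    rw [e, e']
    cases s with
    | nil => rfl
    | cons a l =>
      have := congrArg (Option.map (a :: ·)) (ih l)
      simp only [applyAt]
      revert this
      cases applyAt i g l <;> cases applyAt (i + g.inn + k) h l <;> simp [applyAt]

theorem run_of_isLinkDiagram_append {A B : Word} (h : Word.IsLinkDiagram (A ++ B)) :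
    ∃ s, A.run = some s := by
  have h' : Word.run (A ++ B) = some [] := h
  rw [run_append] at h'
  cases hA : A.run with
  | none => rw [hA] at h'; cases h'
  | some s => exact ⟨s, rfl⟩

theorem runFrom_replicate_cross (L R : List Bool) (a b s : Bool) (m : ℕ) :
    runFrom (L ++ a :: b :: R) (List.replicate m (L.length, Piece.cross s)) =
      some (if Even m then L ++ a :: b :: R else L ++ b :: a :: R) := by
  induction m generalizing a b with
  | zero => simp
  | succ m ih =>
    rw [List.replicate_succ, runFrom_cons]
    simp only [applyAt_append, Piece.apply, Option.map_some, Option.bind_some, ih]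
    by_cases h : Even m <;> simp [h, Nat.even_add_one]

/-! ### Isotopy -/

theorem Isotopic.symm {D D' : Word} (h : Isotopic D D') : Isotopic D' D :=
  Relation.EqvGen.symm _ _ h

theorem Isotopic.trans {D D' D'' : Word} (h : Isotopic D D') (h' : Isotopic D' D'') :
    Isotopic D D'' :=
  Relation.EqvGen.trans _ _ _ h h'

theorem Isotopic.isLinkDiagram_iff {D D' : Word} (h : Isotopic D D') :
    D.IsLinkDiagram ↔ D'.IsLinkDiagram := by
  induction h with
  | rel _ _ h => cases h with | mk A B l l' h hD hD' => exact ⟨fun _ => hD', fun _ => hD⟩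
  | refl => rfl
  | symm _ _ _ ih => exact ih.symm
  | trans _ _ _ _ _ ih ih' => exact ih.trans ih'

theorem HasConwayPolynomial.isLinkDiagram {D : Word} {p : ℤ[X]} (h : HasConwayPolynomial D p) :
    D.IsLinkDiagram := by
  induction h with
  | unknot => rfl
  | isotopic h _ ih => exact h.isLinkDiagram_iff.1 ih
  | skein_pos h => cases h <;> assumption
  | skein_neg h => cases h <;> assumption
  | skein_zero h => cases h <;> assumption

theorem HasConwayPolynomial.congr {D : Word} {p q : ℤ[X]} (h : HasConwayPolynomial D p)
    (hpq : p = q) : HasConwayPolynomial D q := hpq ▸ h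

/-- Two words that may be exchanged for one another at the bottom of the prefix of a diagram:
both are defined from the top, end with the same strand directions, and give isotopic diagrams
however they are completed. -/
structure PrefixIso (w w' : Word) : Prop where
  exists_run : ∃ s, w.run = some s ∧ w'.run = some s
  isotopic : ∀ B, Word.IsLinkDiagram (w ++ B) → Isotopic (w ++ B) (w' ++ B)

namespace PrefixIso

theorem run_eq {w w' : Word} (h : PrefixIso w w') : w.run = w'.run := by
  obtain ⟨s, h₁, h₂⟩ := h.exists_run
  rw [h₁, h₂]

theorem isLinkDiagram_iff {w w' : Word} (h : PrefixIso w w') (B : Word) :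
    Word.IsLinkDiagram (w ++ B) ↔ Word.IsLinkDiagram (w' ++ B) := by
  unfold Word.IsLinkDiagram
  rw [run_append, run_append, h.run_eq]

theorem symm {w w' : Word} (h : PrefixIso w w') : PrefixIso w' w :=
  ⟨let ⟨s, h₁, h₂⟩ := h.exists_run; ⟨s, h₂, h₁⟩,
    fun B hB => (h.isotopic B ((h.isLinkDiagram_iff B).2 hB)).symm⟩

theorem trans {w w' w'' : Word} (h : PrefixIso w w') (h' : PrefixIso w' w'') :
    PrefixIso w w'' :=
  ⟨let ⟨s, h₁, h₂⟩ := h.exists_run; ⟨s, h₁, h'.run_eq ▸ h₂⟩, fun B hB =>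
    (h.isotopic B hB).trans (h'.isotopic B ((h.isLinkDiagram_iff B).1 hB))⟩

theorem of_localMove (A C : Word) {l l' : Word} (h : LocalMove l l') (s : List Bool)
    (hl : Word.run (A ++ l ++ C) = some s) (hl' : Word.run (A ++ l' ++ C) = some s) :
    PrefixIso (A ++ l ++ C) (A ++ l' ++ C) := by
  refine ⟨⟨s, hl, hl'⟩, fun B hB => ?_⟩
  have hB' : Word.IsLinkDiagram (A ++ l' ++ C ++ B) := by
    unfold Word.IsLinkDiagram at hB ⊢
    rwa [run_append, hl', ← hl, ← run_append]
  rw [List.append_assoc] at hB hB'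
  rw [List.append_assoc, List.append_assoc _ C]
  exact .rel _ _ (.mk A (C ++ B) l l' h hB hB')

theorem hasConwayPolynomial {w w' : Word} (h : PrefixIso w w') {B : Word} {p : ℤ[X]}
    (hp : HasConwayPolynomial (w' ++ B) p) : HasConwayPolynomial (w ++ B) p :=
  hp.isotopic (h.symm.isotopic B hp.isLinkDiagram)

end PrefixIso

/-- The word `w` moved to the right by `n` strands. -/
def shift (n : ℕ) (w : Word) : Word := w.map fun p => (p.1 + n, p.2)

/-- Two words that may be exchanged for one another anywhere in a diagram, because they have the
same effect on strand directions and give isotopic diagrams in every context. -/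
structure WordIso (w w' : Word) : Prop where
  runFrom_eq : ∀ s, runFrom s w = runFrom s w'
  isotopic : ∀ A B, Word.IsLinkDiagram (A ++ w ++ B) → Isotopic (A ++ w ++ B) (A ++ w' ++ B)

namespace WordIso

theorem isLinkDiagram_iff {w w' : Word} (h : WordIso w w') (A B : Word) :
    Word.IsLinkDiagram (A ++ w ++ B) ↔ Word.IsLinkDiagram (A ++ w' ++ B) := by
  have e : Word.run (A ++ w) = Word.run (A ++ w') := by
    simp only [run_append, h.runFrom_eq]
  unfold Word.IsLinkDiagram
  rw [run_append (A ++ w), run_append (A ++ w'), e]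

theorem refl (w : Word) : WordIso w w := ⟨fun _ => rfl, fun _ _ _ => .refl _⟩

theorem symm {w w' : Word} (h : WordIso w w') : WordIso w' w :=
  ⟨fun s => (h.runFrom_eq s).symm,
    fun A B hB => (h.isotopic A B ((h.isLinkDiagram_iff A B).2 hB)).symm⟩

theorem trans {w w' w'' : Word} (h : WordIso w w') (h' : WordIso w' w'') : WordIso w w'' :=
  ⟨fun s => (h.runFrom_eq s).trans (h'.runFrom_eq s),
    fun A B hB => (h.isotopic A B hB).trans (h'.isotopic A B ((h.isLinkDiagram_iff A B).1 hB))⟩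

theorem append_left (C : Word) {w w' : Word} (h : WordIso w w') : WordIso (C ++ w) (C ++ w') := by
  refine ⟨fun s => by simp only [runFrom_append, h.runFrom_eq], fun A B hB => ?_⟩
  rw [← List.append_assoc A C] at hB ⊢
  rw [← List.append_assoc A C]
  exact h.isotopic _ _ hB

theorem append_right {w w' : Word} (h : WordIso w w') (C : Word) : WordIso (w ++ C) (w' ++ C) := by
  refine ⟨fun s => by simp only [runFrom_append, h.runFrom_eq], fun A B hB => ?_⟩
  have e : ∀ v : Word, A ++ (v ++ C) ++ B = A ++ v ++ (C ++ B) := by simp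
  rw [e] at hB ⊢
  rw [e]
  exact h.isotopic _ _ hB

theorem cons (p : ℕ × Piece) {w w' : Word} (h : WordIso w w') : WordIso (p :: w) (p :: w') :=
  h.append_left [p]

theorem of_localMove {l l' : Word} (h : LocalMove l l')
    (hrun : ∀ s, runFrom s l = runFrom s l') : WordIso l l' := by
  refine ⟨hrun, fun A B hB => .rel _ _ (.mk A B l l' h hB ?_)⟩
  unfold Word.IsLinkDiagram at hB ⊢
  rw [run_append] at hB ⊢
  rwa [run_append, ← funext hrun, ← run_append]

theorem prefixIso_append_left {w w' : Word} (h : WordIso w w') {A : Word} {s : List Bool}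
    (hs : Word.run (A ++ w') = some s) : PrefixIso (A ++ w) (A ++ w') :=
  ⟨⟨s, by rw [run_append, funext h.runFrom_eq, ← run_append, hs], hs⟩, h.isotopic A⟩

theorem exchange (i k : ℕ) (g h : Piece) :
    WordIso [(i, g), (i + g.out + k, h)] [(i + g.inn + k, h), (i, g)] := by
  refine of_localMove (.exchange i k g h) fun s => ?_
  simpa [runFrom_cons] using applyAt_comm i k g h s

/-- A piece may be moved vertically past a word that lies to its right. -/
theorem piece_comm (i : ℕ) (g : Piece) (w : Word) :
    WordIso ((i, g) :: shift (i + g.out) w) (shift (i + g.inn) w ++ [(i, g)]) := by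
  induction w with
  | nil => exact .refl _
  | cons p w ih =>
    have h := (exchange i p.1 g p.2).append_right (shift (i + g.out) w)
    have h' := ih.cons (p.1 + (i + g.inn), p.2)
    refine .trans (w' := (p.1 + (i + g.inn), p.2) :: (i, g) :: shift (i + g.out) w) ?_ h'
    simpa [shift, add_comm, add_left_comm] using h

end WordIso

/-! ### Pretzel diagrams, column by column -/

/-- The crossings of a column with `a` half-twists, on the strands `n` and `n + 1`. -/
def twists (n : ℕ) (a : ℤ) : Word := List.replicate a.natAbs (n, .cross (decide (0 < a)))

/-- A column together with the bridges that attach it to the columns on its left: the top bridge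
that leads to the next column, directed according to `d`, the crossings, and the bottom bridge
that comes from the previous column.  It starts and ends with four strands, namely the two lower
ends of the columns so far, the loose end of the last top bridge, and the strand that closes up
the diagram on the right. -/
def column (a : ℤ) (d : Bool) : Word := (3, .birth (!d)) :: twists 2 a ++ [(1, .death)]

/-- The top bridges of a pretzel diagram, except for the outermost one. -/
def topBridges (n : ℕ) (t : ℕ → Bool) : Word :=
  (List.range n).map fun i => (2 * i + 1, Piece.birth (!t i))

/-- The bottom bridges of a pretzel diagram, except for the outermost one. -/
def bottomBridges (n : ℕ) : Word := (List.range n).reverse.map fun i => (2 * i + 1, Piece.death)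

/-- The crossings of a pretzel diagram. -/
def allTwists (k : List ℤ) : Word := (k.mapIdx fun i m => twists (2 * i) m).flatten

/-- A pretzel diagram without the two outermost bridges. -/
def pretzelCore (k : List ℤ) (t : ℕ → Bool) : Word :=
  topBridges (k.length - 1) t ++ allTwists k ++ bottomBridges (k.length - 1)

/-- The columns of a pretzel diagram attached to four strands that come from further columns on
the left. -/
def pretzelTail (k : List ℤ) (t : ℕ → Bool) : Word := shift 2 (pretzelCore k t) ++ [(1, .death)]

theorem pretzelWord_eq (k : List ℤ) (t : ℕ → Bool) :
    pretzelWord k t = (0, .birth (t (k.length - 1))) :: pretzelCore k t ++ [(0, .death)] := by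
  simp [pretzelWord, pretzelCore, topBridges, bottomBridges, allTwists, twists]

@[simp] theorem shift_nil (n : ℕ) : shift n [] = [] := rfl

@[simp] theorem shift_cons (n : ℕ) (p : ℕ × Piece) (w : Word) :
    shift n (p :: w) = (p.1 + n, p.2) :: shift n w := rfl

theorem shift_append (n : ℕ) (v w : Word) : shift n (v ++ w) = shift n v ++ shift n w :=
  List.map_append

theorem shift_shift (m n : ℕ) (w : Word) : shift m (shift n w) = shift (m + n) w := by
  simp [shift, add_comm, add_left_comm]

theorem shift_zero (w : Word) : shift 0 w = w := by simp [shift]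

theorem shift_twists (m n : ℕ) (a : ℤ) : shift m (twists n a) = twists (n + m) a := by
  simp [shift, twists]

theorem topBridges_succ (n : ℕ) (t : ℕ → Bool) :
    topBridges (n + 1) t =
      (1, .birth (!t 0)) :: shift 2 (topBridges n fun i => t (i + 1)) := by
  simp only [topBridges, List.range_succ_eq_map, shift, List.map_cons, List.map_map]
  rfl

theorem bottomBridges_succ (n : ℕ) :
    bottomBridges (n + 1) = shift 2 (bottomBridges n) ++ [(1, .death)] := by
  simp only [bottomBridges, List.range_succ_eq_map, shift, List.map_reverse, List.map_map,
    List.reverse_cons, List.map_append]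
  rfl

theorem allTwists_cons (a : ℤ) (k : List ℤ) :
    allTwists (a :: k) = twists 0 a ++ shift 2 (allTwists k) := by
  rw [allTwists, List.mapIdx_cons]
  simp only [allTwists, List.flatten_cons, shift, List.map_flatten, List.mapIdx_eq_zipIdx_map,
    List.map_map]
  congr 3
  funext p
  exact (shift_twists 2 (2 * p.2) p.1).symm

theorem pretzelCore_cons_cons (a b : ℤ) (k : List ℤ) (t : ℕ → Bool) :
    pretzelCore (a :: b :: k) t =
      (1, .birth (!t 0)) :: shift 2 (topBridges k.length fun i => t (i + 1)) ++
        (twists 0 a ++ shift 2 (allTwists (b :: k))) ++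
        (shift 2 (bottomBridges k.length) ++ [(1, .death)]) := by
  rw [pretzelCore, allTwists_cons]
  simp only [List.length_cons, Nat.add_sub_cancel, topBridges_succ, bottomBridges_succ]

theorem twists_comm (n : ℕ) (a : ℤ) (w : Word) :
    WordIso (shift (n + 2) w ++ twists n a) (twists n a ++ shift (n + 2) w) := by
  unfold twists
  induction a.natAbs with
  | zero => simpa using WordIso.refl _
  | succ m ih =>
    rw [List.replicate_succ]
    have h := (WordIso.piece_comm n (.cross (decide (0 < a))) w).symm.append_right
      (List.replicate m (n, .cross (decide (0 < a))))
    have h' := h.trans (ih.cons (n, .cross (decide (0 < a))))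
    simpa [Piece.inn] using h'

/-- The first column of a pretzel diagram can be separated from the others. -/
theorem pretzelTail_cons_cons (a b : ℤ) (k : List ℤ) (t : ℕ → Bool) :
    WordIso (pretzelTail (a :: b :: k) t)
      (column a (t 0) ++ pretzelTail (b :: k) fun i => t (i + 1)) := by
  set T := topBridges k.length fun i => t (i + 1)
  set C := allTwists (b :: k)
  set E := bottomBridges k.length
  have e₁ : pretzelTail (a :: b :: k) t =
      [(3, .birth (!t 0))] ++ (shift 4 T ++ twists 2 a) ++
        (shift 4 C ++ shift 4 E ++ [(3, .death), (1, .death)]) := by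
    simp [pretzelTail, pretzelCore_cons_cons, shift_append, shift_shift, shift_twists, T, C, E]
  have e₂ : (column a (t 0) ++ pretzelTail (b :: k) fun i => t (i + 1)) =
      (3, .birth (!t 0)) :: twists 2 a ++
        ((1, .death) :: shift 1 (shift 1 (T ++ C ++ E) ++ [(0, .death)])) := by
    simp [column, pretzelTail, pretzelCore, shift_append, shift_shift, T, C, E]
  have h₁ := ((twists_comm 2 a T).append_left [(3, .birth (!t 0))]).append_right
    (shift 4 C ++ shift 4 E ++ [(3, .death), (1, .death)])
  have h₂ := (WordIso.piece_comm 1 .death (shift 1 (T ++ C ++ E) ++ [(0, .death)])).symm.append_left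
    ((3, .birth (!t 0)) :: twists 2 a)
  rw [e₁, e₂]
  refine h₁.trans ?_
  convert h₂ using 1
  · simp [shift_append, shift_shift, Piece.inn]
  · rfl

theorem pretzelTail_singleton (a : ℤ) (t : ℕ → Bool) :
    pretzelTail [a] t = twists 2 a ++ [(1, .death)] := by
  simp [pretzelTail, pretzelCore, topBridges, bottomBridges, allTwists, shift_twists]

/-- Two arcs side by side, each with two lower ends: the empty pretzel diagram, to which columns
are attached. -/
def sideArcs (x o : Bool) : Word := [(0, .birth x), (2, .birth o)]

/-- An arc to the left of a word straightens once it is joined to the first strand below it. -/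
theorem leftArc_prefixIso {w : Word} {x : Bool} {l : List Bool} (hw : w.run = some (x :: l)) :
    PrefixIso ((0, .birth x) :: shift 2 w ++ [(1, .death)]) w := by
  have h₁ := ((WordIso.piece_comm 0 (.birth x) w).append_right [(1, .death)]).prefixIso_append_left
    (A := []) (s := x :: l) (by
      simp only [Piece.inn, add_zero, shift_zero, List.nil_append, List.append_assoc,
        List.cons_append]
      rw [run_append_of_run hw]
      cases x <;> rfl)
  have h₂ : PrefixIso (w ++ [(0, .birth x), (0 + 1, .death)] ++ []) (w ++ [] ++ []) :=
    .of_localMove w [] (.zigzagLeft 0 x) (x :: l)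
      (by rw [List.append_nil, run_append_of_run hw]; cases x <;> rfl) (by simpa using hw)
  refine .trans (by simpa [Piece.out] using h₁) ?_
  simpa [Piece.inn, shift_zero] using h₂

/-- A pretzel diagram arises from two arcs side by side by attaching all its columns. -/
theorem exists_isotopic_sideArcs (k : List ℤ) (t : ℕ → Bool)
    (hD : (pretzelWord k t).IsLinkDiagram) :
    ∃ x, Isotopic
      (sideArcs x (t (k.length - 1)) ++ (pretzelTail k t ++ [(0, .death)])) (pretzelWord k t) := by
  set o := t (k.length - 1)
  set w : Word := (0, .birth o) :: pretzelCore k t with hw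
  have hDw : pretzelWord k t = w ++ [(0, .death)] := pretzelWord_eq k t
  rw [hDw] at hD ⊢
  obtain ⟨s, hs⟩ := run_of_isLinkDiagram_append hD
  -- Two strands arrive at the outermost minimum, which ends the diagram.
  obtain ⟨x, l, rfl⟩ : ∃ x l, s = x :: l := by
    unfold Word.IsLinkDiagram at hD
    rw [run_append_of_run hs, runFrom_cons] at hD
    rcases s with _ | ⟨a, l⟩
    · simp [applyAt, Piece.apply] at hD
    · exact ⟨a, l, rfl⟩
  refine ⟨x, ?_⟩
  have h := leftArc_prefixIso hs
  have e : sideArcs x o ++ (pretzelTail k t ++ [(0, .death)]) =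
      (0, .birth x) :: shift 2 w ++ [(1, .death)] ++ [(0, .death)] := by
    simp [sideArcs, pretzelTail, hw]
  rw [e]
  exact h.isotopic _ ((h.isLinkDiagram_iff _).2 hD)

/-! ### Elementary tangles -/

/-- Two nested arcs, with four lower ends: a single column without crossings. -/
def nestedArcs (o t : Bool) : Word := [(0, .birth o), (1, .birth (!t))]

/-- A single column with one crossing. -/
def crossedArcs (o t : Bool) : Word := [(0, .birth o), (1, .birth (!t)), (0, .cross true)]

theorem run_sideArcs (x o : Bool) : (sideArcs x o).run = some [x, !x, o, !o] := by
  cases x <;> cases o <;> rfl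

theorem run_nestedArcs (o t : Bool) : (nestedArcs o t).run = some [o, !t, t, !o] := by
  cases t <;> rfl

theorem run_crossedArcs (o t : Bool) : (crossedArcs o t).run = some [!t, o, t, !o] := by
  cases t <;> rfl

theorem sideArcs_uncrossedColumn (o t : Bool) :
    PrefixIso (sideArcs o o ++ [(3, .birth (!t)), (1, .death)]) (nestedArcs o t) :=
  leftArc_prefixIso (run_nestedArcs o t)

theorem sideArcs_crossedColumn (o t : Bool) :
    PrefixIso (sideArcs (!t) o ++ [(3, .birth (!t)), (2, .cross true), (1, .death)])
      (crossedArcs o t) :=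
  leftArc_prefixIso (run_crossedArcs o t)

/-- The inner arc of two nested arcs slides over a column with one crossing. -/
theorem nestedArcs_crossedColumn (o t s : Bool) :
    PrefixIso (nestedArcs o t ++ [(3, .birth t), (2, .cross s), (1, .death)])
      (nestedArcs o (!t)) := by
  have h₁ := (PrefixIso.of_localMove [(0, .birth o), (1, .birth (!t)), (3, .birth t)] []
    (.slideDeath 1 (!s)) [o, t, !t, !o] (by cases t <;> rfl) (by cases t <;> rfl)).symm
  have h₂ := (PrefixIso.of_localMove [(0, .birth o), (1, .birth (!t))] [(2, .death)]
    (.exchange 1 0 (.cross (!s)) (.birth t)) [o, t, !t, !o]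
    (by cases t <;> rfl) (by cases t <;> rfl)).symm
  have h₃ := PrefixIso.of_localMove [(0, .birth o)] [(3, .birth t), (2, .death)]
    (.reidemeisterOneBirth 1 (!t) (!s)) [o, t, !t, !o] (by cases t <;> rfl) (by cases t <;> rfl)
  have h₄ := PrefixIso.of_localMove [(0, .birth o), (1, .birth (!!t))] []
    (.zigzagRight 2 t) [o, t, !t, !o] (by cases t <;> rfl) (by cases t <;> rfl)
  rw [Bool.not_not] at h₁
  rw [Bool.not_not] at h₃ h₄
  exact h₁.trans (h₂.trans (h₃.trans (by simpa [nestedArcs] using h₄)))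

/-- A single crossing followed by a column without crossings is a kink, which can be removed. -/
theorem crossedArcs_uncrossedColumn (o t : Bool) :
    PrefixIso (crossedArcs o (!o) ++ [(3, .birth (!t)), (1, .death)]) (nestedArcs o t) := by
  have h₁ := (PrefixIso.of_localMove [(0, .birth o), (1, .birth o)] [(1, .death)]
    (.exchange 0 1 (.cross true) (.birth (!t))) [o, !t, t, !o]
    (by cases o <;> cases t <;> rfl) (by cases o <;> cases t <;> rfl))
  have h₂ := (PrefixIso.of_localMove [(0, .birth o), (1, .birth o), (3, .birth (!t))] []
    (.slideDeath 0 true) [o, !t, t, !o]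
    (by cases o <;> cases t <;> rfl) (by cases o <;> cases t <;> rfl))
  have h₃ := (PrefixIso.of_localMove [(0, .birth o), (1, .birth o)] [(0, .death)]
    (.exchange 1 0 (.cross false) (.birth (!t))) [o, !t, t, !o]
    (by cases o <;> cases t <;> rfl) (by cases o <;> cases t <;> rfl)).symm
  have h₄ := PrefixIso.of_localMove [(0, .birth o)] [(3, .birth (!t)), (0, .death)]
    (.reidemeisterOneBirth 1 o false) [o, !t, t, !o]
    (by cases o <;> cases t <;> rfl) (by cases o <;> cases t <;> rfl)
  have h₅ := (PrefixIso.of_localMove [(0, .birth o), (1, .birth (!o))] []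
    (.exchange 0 1 .death (.birth (!t))) [o, !t, t, !o]
    (by cases o <;> cases t <;> rfl) (by cases o <;> cases t <;> rfl)).symm
  have h₆ := (PrefixIso.of_localMove [(0, .birth o)] [(1, .birth (!t))]
    (.zigzagRight 0 (!o)) [o, !t, t, !o]
    (by cases o <;> cases t <;> rfl) (by cases o <;> cases t <;> rfl))
  rw [crossedArcs, Bool.not_not]
  exact h₁.trans (h₂.trans (h₃.trans (h₄.trans (h₅.trans h₆))))

/-- Two neighbouring columns with opposite single crossings cancel by a second Reidemeister move,
once the crossings have been slid to the middle. -/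
theorem crossedArcs_oppositeColumn (o t : Bool) :
    PrefixIso (crossedArcs o t ++ [(3, .birth (!o)), (2, .cross false), (1, .death)])
      (sideArcs (!t) o) := by
  have h₁ := (PrefixIso.of_localMove [(0, .birth o)]
    [(3, .birth (!o)), (2, .cross false), (1, .death)]
    (.slideBirth 0 (!t) true) [!t, t, o, !o]
    (by cases o <;> cases t <;> rfl) (by cases o <;> cases t <;> rfl))
  have h₂ := (PrefixIso.of_localMove
    [(0, .birth o), (0, .birth (!t)), (1, .cross false), (3, .birth (!o))] []
    (.slideDeath 1 true) [!t, t, o, !o]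
    (by cases o <;> cases t <;> rfl) (by cases o <;> cases t <;> rfl)).symm
  have h₃ := (PrefixIso.of_localMove [(0, .birth o), (0, .birth (!t)), (1, .cross false)]
    [(2, .death)] (.exchange 1 0 (.cross true) (.birth (!o))) [!t, t, o, !o]
    (by cases o <;> cases t <;> rfl) (by cases o <;> cases t <;> rfl)).symm
  have h₄ := PrefixIso.of_localMove [(0, .birth o), (0, .birth (!t))]
    [(3, .birth (!o)), (2, .death)]
    (.reidemeisterTwo 1 false) [!t, t, o, !o]
    (by cases o <;> cases t <;> rfl) (by cases o <;> cases t <;> rfl)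
  have h₅ := PrefixIso.of_localMove [(0, .birth o), (0, .birth (!t))] []
    (.zigzagRight 2 (!o)) [!t, t, o, !o]
    (by cases o <;> cases t <;> rfl) (by cases o <;> cases t <;> rfl)
  have h₆ := (PrefixIso.of_localMove [] []
    (.exchange 0 0 (.birth (!t)) (.birth o)) [!t, t, o, !o]
    (by cases o <;> cases t <;> rfl) (by cases o <;> cases t <;> rfl)).symm
  exact h₁.trans (h₂.trans (h₃.trans (h₄.trans (h₅.trans h₆))))

/-- A column cut horizontally disappears. -/
theorem cutColumn_prefixIso {A : Word} {a b c d : Bool} (hA : A.run = some [a, b, c, d]) :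
    PrefixIso (A ++ [(3, .birth (!c)), (2, .death), (2, .birth (!b)), (1, .death)]) A := by
  have run (w : Word) : Word.run (A ++ w) = runFrom [a, b, c, d] w := run_append_of_run hA w
  have h₁ := PrefixIso.of_localMove A [(2, .birth (!b)), (1, .death)] (.zigzagRight 2 (!c))
    [a, b, c, d] (by rw [List.append_assoc, run]; cases b <;> cases c <;> rfl)
    (by rw [List.append_assoc, run]; cases b <;> cases c <;> rfl)
  have h₂ := PrefixIso.of_localMove A [] (.zigzagRight 1 (!b))
    [a, b, c, d] (by rw [List.append_assoc, run]; cases b <;> cases c <;> rfl)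
    (by rw [List.append_assoc, run]; rfl)
  simp only [List.append_assoc, List.nil_append, List.cons_append, List.append_nil] at h₁ h₂
  exact h₁.trans h₂

/-- The last column may be attached like the others, since the strand that leads from it to the
closing bridges can be straightened. -/
theorem lastColumn_prefixIso {A : Word} {a b c d : Bool} (hA : A.run = some [a, b, c, d]) (n : ℤ)
    (hD : Word.IsLinkDiagram (A ++ (twists 2 n ++ [(1, .death), (0, .death)]))) :
    PrefixIso (A ++ (column n (!d) ++ [(2, .death), (0, .death)]))
      (A ++ (twists 2 n ++ [(1, .death), (0, .death)])) := by
  have h₁ : WordIso (column n (!d) ++ [(2, .death), (0, .death)])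
      ((3, .birth d) :: (4, .death) :: twists 2 n ++ [(1, .death), (0, .death)]) := by
    have e₁ := (((WordIso.exchange 1 1 .death .death).append_right [(0, .death)]).append_left
      ((3, .birth d) :: twists 2 n))
    have e₂ := ((twists_comm 2 n [(0, .death)]).symm.append_right
      [(1, .death), (0, .death)]).cons (3, .birth d)
    refine .trans (by simpa [column, Piece.out] using e₁) (.trans ?_ (by simpa using e₂))
    simpa [Piece.inn] using WordIso.refl _
  have run (w : Word) : Word.run (A ++ w) = runFrom [a, b, c, d] w := run_append_of_run hA w
  have hz : ∀ w, runFrom [a, b, c, d] ((3, .birth d) :: (4, .death) :: w) =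
      runFrom [a, b, c, d] w := by intro w; cases d <;> rfl
  have h₂ := PrefixIso.of_localMove A (twists 2 n ++ [(1, .death), (0, .death)])
    (.zigzagLeft 3 d) [] (by
      rw [List.append_assoc, run]
      exact (hz _).trans ((run _).symm.trans hD)) (by simpa [Word.IsLinkDiagram] using hD)
  have h₂' : PrefixIso
      (A ++ ((3, .birth d) :: (4, .death) :: twists 2 n ++ [(1, .death), (0, .death)]))
      (A ++ (twists 2 n ++ [(1, .death), (0, .death)])) := by simpa using h₂
  obtain ⟨s, hs, -⟩ := h₂'.exists_run
  exact (h₁.prefixIso_append_left hs).trans h₂'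

/-! ### Skein relations -/

/-- The sign of a crossing between two strands that run in parallel. -/
noncomputable def crossSign (s : Bool) : ℤ[X] := if s then 1 else -1

theorem HasConwayPolynomial.skein_parallel {A B : Word} {L R : List Bool} {b : Bool}
    (hA : A.run = some (L ++ b :: b :: R)) (s : Bool) {q r : ℤ[X]}
    (hq : HasConwayPolynomial (A ++ (L.length, .cross (!s)) :: B) q)
    (hr : HasConwayPolynomial (A ++ B) r) :
    HasConwayPolynomial (A ++ (L.length, .cross s) :: B) (q + crossSign s * X * r) := by
  have h0 := hr.isLinkDiagram
  have hs : ∀ s, Word.IsLinkDiagram (A ++ [(L.length, .cross s)] ++ B) := by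
    intro s
    unfold Word.IsLinkDiagram at h0 ⊢
    rw [run_append_of_run hA] at h0
    rw [List.append_assoc, run_append_of_run hA, List.singleton_append, runFrom_cons,
      applyAt_append]
    exact h0
  have h := SkeinTriple.parallel A B L R b hA (hs true) (hs false) h0
  have e : ∀ s, A ++ (L.length, .cross s) :: B = A ++ [(L.length, Piece.cross s)] ++ B := by simp
  rw [e] at hq ⊢
  cases s
  · exact (HasConwayPolynomial.skein_neg h hq hr).congr (by simp [crossSign, sub_eq_add_neg])
  · exact (HasConwayPolynomial.skein_pos h hq hr).congr (by simp [crossSign])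

theorem HasConwayPolynomial.skein_antiparallel {A B : Word} {L R : List Bool} {b : Bool}
    (hA : A.run = some (L ++ b :: (!b) :: R)) (s : Bool) {q r : ℤ[X]}
    (hq : HasConwayPolynomial (A ++ (L.length, .cross (!s)) :: B) q)
    (hr : HasConwayPolynomial (A ++ (L.length, .death) :: (L.length, .birth (!b)) :: B) r) :
    HasConwayPolynomial (A ++ (L.length, .cross s) :: B) (q - crossSign s * X * r) := by
  have hs : ∀ s, Word.IsLinkDiagram (A ++ [(L.length, .cross s)] ++ B) := by
    have h0 := hq.isLinkDiagram
    intro s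
    unfold Word.IsLinkDiagram at h0 ⊢
    rw [run_append_of_run hA, runFrom_cons, applyAt_append] at h0
    rw [List.append_assoc, run_append_of_run hA, List.singleton_append, runFrom_cons,
      applyAt_append]
    exact h0
  have e : ∀ s, A ++ (L.length, .cross s) :: B = A ++ [(L.length, Piece.cross s)] ++ B := by simp
  have e' : A ++ (L.length, .death) :: (L.length, .birth (!b)) :: B =
    A ++ [(L.length, .death), (L.length, .birth (!b))] ++ B := by simp
  rw [e'] at hr
  have h := SkeinTriple.antiparallel A B L R b hA (hs false) (hs true) hr.isLinkDiagram
  rw [e] at hq ⊢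
  cases s
  · exact (HasConwayPolynomial.skein_pos h hq hr).congr (by simp [crossSign])
  · exact (HasConwayPolynomial.skein_neg h hq hr).congr (by simp [crossSign])

theorem cross_cancel {A : Word} {L R : List Bool} {a b : Bool}
    (hA : A.run = some (L ++ a :: b :: R)) (s : Bool) :
    PrefixIso (A ++ [(L.length, .cross s), (L.length, .cross (!s))]) A := by
  have h := PrefixIso.of_localMove A [] (.reidemeisterTwo L.length s) (L ++ a :: b :: R) (by
    rw [List.append_nil, run_append_of_run hA]
    simp [runFrom_cons, applyAt_append, Piece.apply]) (by simpa using hA)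
  simpa using h

/-- The Fibonacci polynomials. -/
noncomputable def fibPoly : ℕ → ℤ[X]
  | 0 => 0
  | 1 => 1
  | n + 2 => X * fibPoly (n + 1) + fibPoly n

/-- The coefficient of a single crossing in the skein expansion of `a` half-twists of parallel
strands: the Fibonacci polynomial with index `a`, also for negative `a`. -/
noncomputable def crossCoeff (a : ℤ) : ℤ[X] :=
  if 0 < a then fibPoly a.natAbs else (-1) ^ (a.natAbs + 1) * fibPoly a.natAbs

/-- The coefficient of two strands without crossings in the skein expansion of `a` half-twists of
parallel strands: the Fibonacci polynomial with index `a - 1`, also for negative `a`. -/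
noncomputable def flatCoeff (a : ℤ) : ℤ[X] :=
  if 0 < a then fibPoly (a.natAbs + 1) - X * fibPoly a.natAbs
  else (-1) ^ a.natAbs * fibPoly (a.natAbs + 1)

theorem replicate_two_append (m n : ℕ) (p : Piece) (B : Word) :
    List.replicate (m + 2) (n, p) ++ B =
      List.replicate (m + 1) (n, p) ++ (n, p) :: B := by
  rw [List.replicate_succ', List.append_assoc]; rfl

/-- Skein expansion of a column of parallel strands. -/
theorem HasConwayPolynomial.twists_parallel {A B : Word} {L R : List Bool} {b : Bool}
    (hA : A.run = some (L ++ b :: b :: R)) {p q : ℤ[X]}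
    (h₁ : HasConwayPolynomial (A ++ (L.length, .cross true) :: B) p)
    (h₀ : HasConwayPolynomial (A ++ B) q) (a : ℤ) :
    HasConwayPolynomial (A ++ (twists L.length a ++ B)) (crossCoeff a * p + flatCoeff a * q) := by
  -- Changing the last of `m + 2` crossings leaves `m` crossings, smoothing it leaves `m + 1`.
  have step : ∀ (s : Bool) (m : ℕ) (x y : ℤ[X]),
      HasConwayPolynomial (A ++ (List.replicate m (L.length, .cross s) ++ B)) x →
      HasConwayPolynomial (A ++ (List.replicate (m + 1) (L.length, .cross s) ++ B)) y →
      HasConwayPolynomial (A ++ (List.replicate (m + 2) (L.length, .cross s) ++ B))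
        (x + crossSign s * X * y) := by
    intro s m x y hx hy
    have hrun : ∀ m, Word.run (A ++ List.replicate m (L.length, .cross s)) =
        some (L ++ b :: b :: R) := by
      intro m
      rw [run_append_of_run hA, runFrom_replicate_cross, ite_self]
    rw [replicate_two_append, ← List.append_assoc]
    refine .skein_parallel (hrun (m + 1)) s ?_ (by rwa [List.append_assoc])
    have h := (cross_cancel (hrun m) s).hasConwayPolynomial (by rwa [List.append_assoc])
    rw [List.replicate_succ']
    simpa using h
  unfold twists
  by_cases ha : 0 < a
  · simp only [ha, decide_true, crossCoeff, flatCoeff, if_true]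
    induction a.natAbs using Nat.twoStepInduction with
    | zero => exact h₀.congr (by simp [fibPoly])
    | one => exact h₁.congr (by simp [fibPoly])
    | more m ih₁ ih₂ =>
      refine (step true m _ _ ih₁ ih₂).congr ?_
      simp only [crossSign, fibPoly, if_true]
      ring
  · simp only [ha, decide_false, crossCoeff, flatCoeff, if_false]
    induction a.natAbs using Nat.twoStepInduction with
    | zero => exact h₀.congr (by simp [fibPoly])
    | one => exact (h₁.skein_parallel hA false h₀).congr (by simp [fibPoly, crossSign])
    | more m ih₁ ih₂ =>
      refine (step false m _ _ ih₁ ih₂).congr ?_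
      simp only [crossSign, fibPoly, pow_succ]
      simp
      ring

theorem runFrom_cross_death (n : ℕ) (s : Bool) (l : List Bool) :
    runFrom l [(n, .cross s), (n, .death)] = runFrom l [(n, .death)] := by
  induction n generalizing l with
  | zero =>
    rcases l with _ | ⟨a, _ | ⟨b, l⟩⟩
    · rfl
    · rfl
    · simp [runFrom_cons, applyAt, Piece.apply, eq_comm]
  | succ n ih =>
    cases l with
    | nil => rfl
    | cons a l =>
      have := congrArg (Option.map (a :: ·)) (ih l)
      simp only [runFrom_cons, applyAt] at this ⊢
      revert this
      cases applyAt n (.cross s) l <;> cases applyAt n .death l <;> simp [applyAt]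

/-- Twists above a minimum can be undone. -/
theorem replicate_cross_death (m n : ℕ) (s : Bool) :
    WordIso (List.replicate m (n, .cross s) ++ [(n, .death)]) [(n, .death)] := by
  induction m with
  | zero => exact .refl _
  | succ m ih =>
    exact (ih.cons _).trans
      (.of_localMove (.reidemeisterOneDeath n s) (runFrom_cross_death n s))

/-- Skein expansion of a column of antiparallel strands.  The parity of the number of crossings
cannot be changed, so there are two cases. -/
theorem HasConwayPolynomial.twists_antiparallel {A B : Word} {L R : List Bool} {b : Bool}
    (hA : A.run = some (L ++ b :: (!b) :: R)) {p q : ℤ[X]} (a : ℤ)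
    (h₁ : HasConwayPolynomial
      (A ++ (List.replicate (a.natAbs % 2) (L.length, .cross true) ++ B)) p)
    (h₀ : HasConwayPolynomial (A ++ (L.length, .death) ::
      (L.length, .birth (if Even a.natAbs then b else !b)) :: B) q) :
    HasConwayPolynomial (A ++ (twists L.length a ++ B)) (p - C (a / 2) * X * q) := by
  -- Changing the last of `m + 2` crossings leaves `m` crossings.  Smoothing it cuts the column, and
  -- the other crossings are then undone by first Reidemeister moves.
  have step : ∀ (s : Bool) (m : ℕ) (x : ℤ[X]), m % 2 = a.natAbs % 2 →
      HasConwayPolynomial (A ++ (List.replicate m (L.length, .cross s) ++ B)) x →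
      HasConwayPolynomial (A ++ (List.replicate (m + 2) (L.length, .cross s) ++ B))
        (x - crossSign s * X * q) := by
    intro s m x hm hx
    have hpar : Even m ↔ Even a.natAbs := by rw [Nat.even_iff, Nat.even_iff, hm]
    have hrun : ∀ m, Word.run (A ++ List.replicate m (L.length, .cross s)) =
        some (L ++ (if Even m then b else !b) :: (!(if Even m then b else !b)) :: R) := by
      intro m
      rw [run_append_of_run hA, runFrom_replicate_cross]
      split_ifs <;> simp
    rw [replicate_two_append, ← List.append_assoc]
    refine .skein_antiparallel (hrun (m + 1)) s ?_ ?_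
    · have h := (cross_cancel (hrun m) s).hasConwayPolynomial (by rwa [List.append_assoc])
      rw [List.replicate_succ']
      simpa using h
    · have e : (!(if Even (m + 1) then b else !b)) = if Even a.natAbs then b else !b := by
        by_cases h : Even a.natAbs <;> simp [Nat.even_add_one, hpar, h]
      rw [e]
      have hw := ((replicate_cross_death (m + 1) L.length s).symm).isotopic A
        ((L.length, .birth (if Even a.natAbs then b else !b)) :: B)
        (by simpa using h₀.isLinkDiagram)
      refine HasConwayPolynomial.isotopic ?_ h₀
      simpa using hw
  have iter : ∀ (s : Bool) (r j : ℕ) (x : ℤ[X]), r % 2 = a.natAbs % 2 →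
      HasConwayPolynomial (A ++ (List.replicate r (L.length, .cross s) ++ B)) x →
      HasConwayPolynomial (A ++ (List.replicate (2 * j + r) (L.length, .cross s) ++ B))
        (x - (j : ℤ[X]) * crossSign s * X * q) := by
    intro s r j x hr hx
    induction j with
    | zero => simpa using hx
    | succ j ih =>
      have e : 2 * (j + 1) + r = 2 * j + r + 2 := by ring
      rw [e]
      refine (step s (2 * j + r) _ (by omega) ih).congr ?_
      push_cast
      ring
  unfold twists
  rcases Nat.even_or_odd' a.natAbs with ⟨j, hj | hj⟩
  · have hm : a.natAbs % 2 = 0 := by omega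
    rw [hm] at h₁
    by_cases ha : 0 < a
    · have hd : a / 2 = j := by omega
      have h := iter true 0 j p (by omega) h₁
      simp only [ha, decide_true, hj, hd]
      exact h.congr (by simp [crossSign])
    · have hd : a / 2 = -j := by omega
      have h := iter false 0 j p (by omega) h₁
      simp only [ha, decide_false, hj, hd]
      exact h.congr (by simp [crossSign])
  · have hm : a.natAbs % 2 = 1 := by omega
    rw [hm] at h₁
    by_cases ha : 0 < a
    · have hd : a / 2 = j := by omega
      have h := iter true 1 j p (by omega) h₁
      simp only [ha, decide_true, hj, hd]
      exact h.congr (by simp [crossSign])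
    · -- The base of the expansion is a crossing of type `true`, so one more crossing is changed
      -- than for positive `a`; this agrees with the rounding of `a / 2`.
      have hd : a / 2 = -(j + 1) := by omega
      have hE : ¬ Even a.natAbs := by rw [Nat.even_iff, hm]; simp
      have h₁' : HasConwayPolynomial
          (A ++ (List.replicate 1 (L.length, .cross false) ++ B)) (p + X * q) := by
        rw [if_neg hE] at h₀
        exact (HasConwayPolynomial.skein_antiparallel hA false h₁ h₀).congr
          (by simp [crossSign])
      have h := iter false 1 j _ (by omega) h₁'
      simp only [ha, decide_false, hj, hd]
      refine h.congr ?_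
      simp [crossSign]
      ring

/-! ### Split circles -/

theorem applyAt_append_succ (g : Piece) (L R : List Bool) (b : Bool) :
    applyAt (L.length + 1) g (L ++ b :: R) = (g.apply R).map (L ++ b :: ·) := by
  simpa using applyAt_append g (L ++ [b]) R

/-- A kink at the strand number `L.length` can be removed. -/
theorem kink_prefixIso {A : Word} {L R : List Bool} {b : Bool}
    (hA : A.run = some (L ++ b :: R)) (s : Bool) :
    PrefixIso (A ++ [(L.length + 1, .birth b), (L.length, .cross s), (L.length + 1, .death)]) A := by
  have run (w : Word) : Word.run (A ++ w) = runFrom (L ++ b :: R) w := run_append_of_run hA w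
  have h₁ := PrefixIso.of_localMove (A ++ [(L.length + 1, .birth b)]) []
    (.slideDeath L.length s) (L ++ b :: R)
    (by simp [run, runFrom_cons, applyAt_append, applyAt_append_succ, Piece.apply])
    (by simp [run, runFrom_cons, applyAt_append, applyAt_append_succ, Piece.apply])
  have h₂ := PrefixIso.of_localMove A [(L.length, .death)]
    (.reidemeisterOneBirth (L.length + 1) b (!s)) (L ++ b :: R)
    (by simp [run, runFrom_cons, applyAt_append, applyAt_append_succ, Piece.apply])
    (by simp [run, runFrom_cons, applyAt_append, applyAt_append_succ, Piece.apply])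
  have h₃ := PrefixIso.of_localMove A [] (.zigzagRight L.length (!b)) (L ++ b :: R)
    (by simp [run, runFrom_cons, applyAt_append, applyAt_append_succ, Piece.apply])
    (by simpa using hA)
  simp only [List.append_assoc, List.nil_append, List.cons_append, List.append_nil] at h₁ h₂ h₃
  exact h₁.trans (h₂.trans h₃)

/-- The orientation of a circle without crossings may be reversed. -/
theorem circle_reverse {A : Word} {s : List Bool} (n : ℕ) (d : Bool)
    (hA : Word.run (A ++ [(n, .birth d), (n, .death)]) = some s)
    (hA' : Word.run (A ++ [(n, .birth (!d)), (n, .death)]) = some s) :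
    PrefixIso (A ++ [(n, .birth (!d)), (n, .death)]) (A ++ [(n, .birth d), (n, .death)]) := by
  have e : runFrom [] (A ++ [(n, .birth d)] ++ [(n, .cross true), (n, .death)]) =
      runFrom [] (A ++ [(n, .birth d)] ++ [(n, .death)]) := by
    rw [runFrom_append, funext (runFrom_cross_death n true), ← runFrom_append]
  have h : Word.run (A ++ [(n, .birth d), (n, .cross true)] ++ [(n, .death)]) = some s := by
    simpa [run_eq_runFrom] using e.trans (by simpa [run_eq_runFrom] using hA)
  have h₁ := PrefixIso.of_localMove A [(n, .death)] (.reidemeisterOneBirth n d true) s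
    h (by simpa using hA')
  have h₂ := PrefixIso.of_localMove (A ++ [(n, .birth d)]) [] (.reidemeisterOneDeath n true) s
    (by simpa using h) (by simpa using hA)
  simp only [List.append_assoc, List.nil_append, List.cons_append, List.append_nil] at h₁ h₂
  exact h₁.symm.trans h₂

/-- A diagram with a split circle has Conway polynomial `0`, since the circle can be connected to
a neighbouring strand by a kink of either sign. -/
theorem HasConwayPolynomial.circle_eq_zero {A B : Word} {L R : List Bool} {b : Bool}
    (hA : A.run = some (L ++ b :: R)) {q : ℤ[X]} (hq : HasConwayPolynomial (A ++ B) q) (d : Bool) :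
    HasConwayPolynomial (A ++ (L.length + 1, .birth d) :: (L.length + 1, .death) :: B) 0 := by
  have run (w : Word) : Word.run (A ++ w) = runFrom (L ++ b :: R) w := run_append_of_run hA w
  have hrun : ∀ d, Word.run (A ++ [(L.length + 1, .birth d), (L.length + 1, .death)]) =
      some (L ++ b :: R) := by
    intro d
    cases d <;> simp [run, runFrom_cons, applyAt_append_succ, Piece.apply]
  have key : HasConwayPolynomial
      (A ++ (L.length + 1, .birth b) :: (L.length + 1, .death) :: B) 0 := by
    have hk : ∀ s, HasConwayPolynomial (A ++ [(L.length + 1, .birth b)] ++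
        [(L.length, .cross s)] ++ (L.length + 1, .death) :: B) q := fun s => by
      simpa using (kink_prefixIso hA s).hasConwayPolynomial hq
    have h0 : Word.IsLinkDiagram
        (A ++ [(L.length + 1, .birth b)] ++ (L.length + 1, .death) :: B) := by
      have h := hq.isLinkDiagram
      unfold Word.IsLinkDiagram at h ⊢
      rw [run_append, hA] at h
      have e : A ++ [(L.length + 1, .birth b)] ++ (L.length + 1, .death) :: B =
        A ++ [(L.length + 1, .birth b), (L.length + 1, .death)] ++ B := by simp
      rw [e, run_append, hrun]
      exact h
    have h := SkeinTriple.parallel (A ++ [(L.length + 1, .birth b)])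
      ((L.length + 1, .death) :: B) L ((!b) :: R) b
      (by simp [run, runFrom_cons, applyAt_append_succ, Piece.apply])
      (hk true).isLinkDiagram (hk false).isLinkDiagram h0
    simpa using HasConwayPolynomial.skein_zero h ((hk true).congr (by simp)) (hk false)
  by_cases hd : d = b
  · rwa [hd]
  · obtain rfl : d = !b := by cases d <;> cases b <;> simp_all
    have h := circle_reverse (L.length + 1) b (hrun _) (hrun _)
    simpa using h.hasConwayPolynomial (B := B) (by simpa using key)

theorem hasConwayPolynomial_circle (o : Bool) :
    HasConwayPolynomial [(0, .birth o), (0, .death)] 1 := by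
  cases o
  · exact (circle_reverse (A := []) (s := []) 0 true rfl rfl).hasConwayPolynomial (B := []) .unknot
  · exact .unknot

/-! ### Closing up elementary tangles -/

theorem hasConwayPolynomial_sideArcs (x o : Bool) :
    HasConwayPolynomial (sideArcs x o ++ [(2, .death), (0, .death)]) 0 :=
  HasConwayPolynomial.circle_eq_zero (A := [(0, .birth x)]) (L := [x]) (R := []) (b := !x)
    (by cases x <;> rfl) (hasConwayPolynomial_circle x) o

theorem nestedArcs_closure_prefixIso (o : Bool) :
    PrefixIso (nestedArcs o o ++ [(2, .death), (0, .death)]) [(0, .birth o), (0, .death)] :=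
  .of_localMove [(0, .birth o)] [(0, .death)] (.zigzagLeft 1 (!o)) []
    (by cases o <;> rfl) (by cases o <;> rfl)

theorem hasConwayPolynomial_nestedArcs (o : Bool) :
    HasConwayPolynomial (nestedArcs o o ++ [(2, .death), (0, .death)]) 1 := by
  simpa using (nestedArcs_closure_prefixIso o).hasConwayPolynomial (B := [])
    (hasConwayPolynomial_circle o)

theorem hasConwayPolynomial_crossedArcs (o : Bool) :
    HasConwayPolynomial (crossedArcs o o ++ [(2, .death), (0, .death)]) 1 := by
  have h₁ := (PrefixIso.of_localMove [(0, .birth o), (1, .birth (!o))] [(0, .death)]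
    (.exchange 0 0 (.cross true) .death) [] (by cases o <;> rfl) (by cases o <;> rfl))
  have h₂ := (PrefixIso.of_localMove [(0, .birth o), (1, .birth (!o)), (2, .death)] []
    (.reidemeisterOneDeath 0 true) [] (by cases o <;> rfl) (by cases o <;> rfl))
  have h := h₁.trans (h₂.trans (nestedArcs_closure_prefixIso o))
  have h' := h.hasConwayPolynomial (B := []) (hasConwayPolynomial_circle o)
  rwa [List.append_nil] at h'

/-! ### Skein expansions of the columns attached so far -/

/-- In every completion to a diagram, the Conway polynomial of `A` is the combination of those of
`E₁` and `E₂` with coefficients `p` and `q`. -/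
def Expands (A E₁ E₂ : Word) (p q : ℤ[X]) : Prop :=
  ∀ (B : Word) (x y : ℤ[X]), HasConwayPolynomial (E₁ ++ B) x → HasConwayPolynomial (E₂ ++ B) y →
    HasConwayPolynomial (A ++ B) (p * x + q * y)

theorem Expands.refl (E₁ E₂ : Word) : Expands E₁ E₁ E₂ 1 0 :=
  fun _ _ _ hx _ => hx.congr (by simp)

theorem append_column_append (A B : Word) (n : ℤ) (d : Bool) :
    A ++ column n d ++ B = A ++ [(3, .birth (!d))] ++ (twists 2 n ++ (1, .death) :: B) := by
  simp [column]

theorem run_append_column {A : Word} {a b c d : Bool} (hA : A.run = some [a, b, c, d]) (n : ℤ)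
    (e : Bool) : Word.run (A ++ column n e) =
      if Even n.natAbs then (if b = c then none else some [a, !e, e, d])
      else (if b = !e then none else some [a, c, e, d]) := by
  have h : runFrom [a, b, c, !e, e, d] (twists 2 n) = _ :=
    runFrom_replicate_cross [a, b] [e, d] c (!e) (decide (0 < n)) n.natAbs
  have h₀ : applyAt 3 (.birth (!e)) [a, b, c, d] = some [a, b, c, !e, e, d] := by
    simp [applyAt, Piece.apply]
  rw [run_append_of_run hA, column, List.cons_append, runFrom_cons, h₀, Option.bind_some,
    runFrom_append, h, Option.bind_some]
  by_cases hn : Even n.natAbs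
  · simp only [hn, if_true]
    cases b <;> cases c <;> rfl
  · simp only [hn, if_false]
    cases b <;> cases e <;> rfl

/-- The tangle that is used besides `nestedArcs o t` for expansions in diagrams without odd columns
of antiparallel strands, where `t` is the direction of the last top bridge so far.  Strand
directions force the choice: two arcs side by side after an even number of columns of parallel
strands, a single crossing after an odd number of them. -/
def mixedBasis (o t : Bool) : Word := if t = o then sideArcs o o else crossedArcs o t

theorem mixedBasis_self (o : Bool) : mixedBasis o o = sideArcs o o := if_pos rfl

theorem mixedBasis_not (o : Bool) : mixedBasis o (!o) = crossedArcs o (!o) := by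
  simp [mixedBasis]

theorem mixedBasis_uncrossedColumn (o t d : Bool) :
    PrefixIso (mixedBasis o t ++ [(3, .birth (!d)), (1, .death)]) (nestedArcs o d) := by
  by_cases h : t = o
  · subst h
    rw [mixedBasis_self]
    exact sideArcs_uncrossedColumn t d
  · obtain rfl : t = !o := by cases t <;> cases o <;> simp_all
    rw [mixedBasis_not]
    exact crossedArcs_uncrossedColumn o d

/-- A second column without crossings splits off a circle. -/
theorem hasConwayPolynomial_nestedArcs_uncrossedColumn {o d : Bool} {B : Word} {y : ℤ[X]}
    (hy : HasConwayPolynomial (nestedArcs o d ++ B) y) (t : Bool) :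
    HasConwayPolynomial (nestedArcs o t ++ (3, .birth (!d)) :: (1, .death) :: B) 0 := by
  have h₁ := (PrefixIso.of_localMove [(0, .birth o), (1, .birth (!t))] []
    (.exchange 1 0 .death (.birth (!d))) [o, !d, d, !o]
    (by cases o <;> cases d <;> cases t <;> rfl) (by cases o <;> cases d <;> cases t <;> rfl)).symm
  exact h₁.hasConwayPolynomial (B := B) (HasConwayPolynomial.circle_eq_zero (A := [(0, .birth o)])
    (L := []) (R := [!o]) (b := o) rfl hy (!t))

section Mixed

variable {o t : Bool} {A : Word} {p q : ℤ[X]}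

theorem Expands.uncrossedColumn (h : Expands A (mixedBasis o t) (nestedArcs o t) p q) {d : Bool}
    {B : Word} {y : ℤ[X]} (hy : HasConwayPolynomial (nestedArcs o d ++ B) y) :
    HasConwayPolynomial (A ++ (3, .birth (!d)) :: (1, .death) :: B) (p * y) := by
  have hx := (mixedBasis_uncrossedColumn o t d).hasConwayPolynomial hy
  rw [List.append_assoc] at hx
  exact (h _ _ _ hx (hasConwayPolynomial_nestedArcs_uncrossedColumn hy t)).congr (by ring)

theorem Expands.antiparallelColumn (h : Expands A (mixedBasis o t) (nestedArcs o t) p q)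
    (hA : A.run = some [o, !t, t, !o]) {n : ℤ} (hn : Even n.natAbs) :
    Expands (A ++ column n t) (mixedBasis o t) (nestedArcs o t)
      (-(C (n / 2) * X) * p) (p - C (n / 2) * X * q) := by
  intro B x y hx hy
  have hA' : Word.run (A ++ [(3, .birth (!t))]) = some ([o, !t] ++ t :: (!t) :: [t, !o]) := by
    rw [run_append_of_run hA]
    cases t <;> rfl
  have h₁ := h.uncrossedColumn hy
  have h₀ := (cutColumn_prefixIso hA).hasConwayPolynomial (h B x y hx hy)
  have hc := HasConwayPolynomial.twists_antiparallel (B := (1, .death) :: B) hA' n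
    (by rw [Nat.even_iff.1 hn]; simpa using h₁) (by simpa [hn] using h₀)
  rw [append_column_append]
  exact hc.congr (by ring)

theorem Expands.parallelColumn (h : Expands A (mixedBasis o t) (nestedArcs o t) p q)
    (hA : A.run = some [o, !t, t, !o]) (n : ℤ) :
    Expands (A ++ column n (!t)) (mixedBasis o (!t)) (nestedArcs o (!t)) (crossCoeff n * p)
      (crossCoeff n * (q + if t = o then 0 else X * p) + flatCoeff n * p) := by
  intro B x y hx hy
  have hA' : Word.run (A ++ [(3, .birth t)]) = some ([o, !t] ++ t :: t :: [!t, !o]) := by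
    rw [run_append_of_run hA]
    cases t <;> rfl
  have h₀ := h.uncrossedColumn hy
  rw [Bool.not_not] at h₀
  have hE₂ := (nestedArcs_crossedColumn o t true).hasConwayPolynomial hy
  rw [List.append_assoc] at hE₂
  have hE₁ : HasConwayPolynomial
      (mixedBasis o t ++ ([(3, .birth t), (2, .cross true), (1, .death)] ++ B))
      (x + if t = o then 0 else X * y) := by
    rw [← List.append_assoc]
    by_cases ht : t = o
    · subst ht
      rw [mixedBasis_not] at hx
      have h' := (sideArcs_crossedColumn t (!t)).hasConwayPolynomial hx
      rw [Bool.not_not] at h'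
      rw [mixedBasis_self]
      exact h'.congr (by simp)
    · obtain rfl : t = !o := by cases t <;> cases o <;> simp_all
      rw [Bool.not_not, mixedBasis_self] at hx
      rw [Bool.not_not] at hy
      have hrun : Word.run (crossedArcs o (!o) ++ [(3, .birth (!o))]) =
          some ([o, o] ++ (!o) :: (!o) :: [o, !o]) := by
        cases o <;> rfl
      have h₁ := (crossedArcs_oppositeColumn o (!o)).hasConwayPolynomial (B := B) (p := x)
        (by rwa [Bool.not_not])
      have h₂ := (crossedArcs_uncrossedColumn o o).hasConwayPolynomial hy
      have h₃ := HasConwayPolynomial.skein_parallel (B := (1, .death) :: B) hrun true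
        (q := x) (r := y) (by simpa using h₁) (by simpa using h₂)
      rw [mixedBasis_not]
      have h₄ := h₃.congr (q := x + if (!o) = o then 0 else X * y) (by simp [crossSign])
      simpa using h₄
  have h₁ := h _ _ _ hE₁ hE₂
  have hc := HasConwayPolynomial.twists_parallel (B := (1, .death) :: B) hA'
    (by simpa using h₁) (by simpa using h₀) n
  rw [append_column_append, Bool.not_not]
  refine hc.congr ?_
  split_ifs <;> ring

end Mixed

theorem Expands.oddColumn {o : Bool} {A : Word} {p q : ℤ[X]}
    (h : Expands A (sideArcs (!o) o) (crossedArcs o o) p q)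
    (hA : A.run = some [!o, o, o, !o]) {n : ℤ} (hn : ¬ Even n.natAbs) :
    Expands (A ++ column n o) (sideArcs (!o) o) (crossedArcs o o)
      (q - C (n / 2) * X * p) (p - X * q - C (n / 2) * X * q) := by
  intro B x y hx hy
  have hrun : ∀ {A : Word}, A.run = some [!o, o, o, !o] →
      Word.run (A ++ [(3, .birth (!o))]) = some ([!o, o] ++ o :: (!o) :: [o, !o]) := by
    intro A hA
    rw [run_append_of_run hA]
    cases o <;> rfl
  have hE₁ := (sideArcs_crossedColumn o o).hasConwayPolynomial hy
  have hE₂ : HasConwayPolynomial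
      (crossedArcs o o ++ ([(3, .birth (!o)), (2, .cross true), (1, .death)] ++ B))
      (x - X * y) := by
    have h₁ := (crossedArcs_oppositeColumn o o).hasConwayPolynomial hx
    have h₂ := (cutColumn_prefixIso (run_crossedArcs o o)).hasConwayPolynomial hy
    have h₃ := HasConwayPolynomial.skein_antiparallel (B := (1, .death) :: B)
      (hrun (run_crossedArcs o o)) true (q := x) (r := y) (by simpa using h₁) (by simpa using h₂)
    have h₄ := h₃.congr (q := x - X * y) (by simp [crossSign])
    simpa using h₄
  rw [List.append_assoc] at hE₁
  have h₁ := h _ _ _ hE₁ hE₂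
  have h₀ := (cutColumn_prefixIso hA).hasConwayPolynomial (h B x y hx hy)
  have hm : n.natAbs % 2 = 1 := by rwa [← Nat.not_even_iff]
  have hc := HasConwayPolynomial.twists_antiparallel (B := (1, .death) :: B) (hrun hA) n
    (by rw [hm]; simpa using h₁) (by simpa [hn] using h₀)
  rw [append_column_append]
  exact hc.congr (by ring)

/-! ### Products over the columns -/

/-- The product of the contributions `f a par` of all columns, where `a` is the number of
half-twists and `par` says whether the strands of the column are parallel, i.e. whether its two
top bridges have different directions; `t₀` is the direction of the bridge on the left. -/
def columnProd {M : Type*} [Monoid M] (f : ℤ → Bool → M) : Bool → List ℤ → (ℕ → Bool) → M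
  | _, [], _ => 1
  | t₀, a :: k, t => f a (t₀ != t 0) * columnProd f (t 0) k fun i => t (i + 1)

theorem columnProd_ofFn {M : Type*} [CommMonoid M] (f : ℤ → Bool → M) {n : ℕ} (k : Fin n → ℤ)
    (t₀ : Bool) (t : ℕ → Bool) :
    columnProd f t₀ (List.ofFn k) t =
      ∏ i : Fin n, f (k i) ((if (i : ℕ) = 0 then t₀ else t (i - 1)) != t i) := by
  induction n generalizing t₀ t with
  | zero => simp [columnProd]
  | succ n ih =>
    rw [List.ofFn_succ, columnProd, ih, Fin.prod_univ_succ]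
    congr 1
    refine Finset.prod_congr rfl fun i _ => ?_
    rcases i with ⟨i, hi⟩
    cases i <;> simp

/-- An invariant `P t A W` of tangles `A` with four lower ends that is preserved, up to a factor
`f a par`, by attaching columns shows that the Conway polynomial of a pretzel diagram vanishes, if
`V W` implies this for the closure of every tangle with that invariant. -/
theorem hasConwayPolynomial_of_invariant {M : Type*} [CommMonoid M] {f : ℤ → Bool → M} {o : Bool}
    {P : Bool → Word → M → Prop} {V : M → Prop}
    (hrun : ∀ {t A W}, P t A W → ∃ a b c, A.run = some [a, b, c, !o])
    (hcol : ∀ {t A W} (n : ℤ) (d : Bool), P t A W → (∃ s, Word.run (A ++ column n d) = some s) →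
      P d (A ++ column n d) (W * f n (t != d)))
    (hclose : ∀ {A W}, P o A W → V W → HasConwayPolynomial (A ++ [(2, .death), (0, .death)]) 0)
    (k : List ℤ) (hk : k ≠ []) (t : ℕ → Bool) (ht : t (k.length - 1) = o) {t₀ : Bool} {A : Word}
    {W : M} (hP : P t₀ A W) (hD : Word.IsLinkDiagram (A ++ (pretzelTail k t ++ [(0, .death)])))
    (hV : V (W * columnProd f t₀ k t)) :
    HasConwayPolynomial (A ++ (pretzelTail k t ++ [(0, .death)])) 0 := by
  induction k generalizing t t₀ A W with
  | nil => exact absurd rfl hk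
  | cons a k ih =>
    rcases k with _ | ⟨b, k⟩
    · obtain ⟨x, y, z, hA⟩ := hrun hP
      have e : pretzelTail [a] t ++ [(0, .death)] = twists 2 a ++ [(1, .death), (0, .death)] := by
        simp [pretzelTail_singleton]
      rw [e] at hD ⊢
      have h := lastColumn_prefixIso hA a hD
      have ht' : t 0 = o := ht
      rw [Bool.not_not, ← List.append_assoc] at h
      obtain ⟨s, hs, -⟩ := h.exists_run
      have hc := hcol a o hP (run_of_isLinkDiagram_append (by
        have := (h.isLinkDiagram_iff []).2 (by simpa using hD)
        simpa using this))
      have hv := hclose hc (by simpa [columnProd, ht'] using hV)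
      simpa using h.symm.hasConwayPolynomial (B := []) (by simpa using hv)
    · have h := (pretzelTail_cons_cons a b k t).append_right [(0, .death)]
      have h' := (h.isLinkDiagram_iff A []).1 (by simpa using hD)
      have e : A ++ (column a (t 0) ++ pretzelTail (b :: k) (fun i => t (i + 1)) ++
          [(0, .death)]) ++ [] = A ++ column a (t 0) ++
          (pretzelTail (b :: k) (fun i => t (i + 1)) ++ [(0, .death)]) := by simp
      have hi := h.isotopic A [] (by simpa using hD)
      rw [e] at h' hi
      have hc := hcol a (t 0) hP (run_of_isLinkDiagram_append h')
      have hv := ih (by simp) (fun i => t (i + 1)) ht hc h'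
        (by simpa [columnProd, mul_assoc] using hV)
      rw [List.append_nil] at hi
      exact hv.isotopic hi.symm

/-- A product over a set with a fixed-point-free involution lies in a submonoid as soon as this
holds for the products of paired factors. -/
theorem prod_mem_of_involution {ι M : Type*} [Fintype ι] [LinearOrder ι] [CommMonoid M]
    (σ : Equiv.Perm ι) (hσ : ∀ i, σ (σ i) = i) (hne : ∀ i, σ i ≠ i) (g : ι → M) (S : Submonoid M)
    (h : ∀ i, g i * g (σ i) ∈ S) : ∏ i, g i ∈ S := by
  have e : ∏ i with ¬ i < σ i, g i = ∏ i with i < σ i, g (σ i) := by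
    refine Finset.prod_nbij' σ σ ?_ ?_ ?_ ?_ ?_
    · intro i hi
      have hi' := not_lt.1 (Finset.mem_filter.1 hi).2
      simpa [hσ] using lt_of_le_of_ne hi' (hne i)
    · intro i hi
      simpa [hσ] using (Finset.mem_filter.1 hi).2.le
    · intro i _
      exact hσ i
    · intro i _
      exact hσ i
    · intro i _
      rw [hσ]
  rw [← Finset.prod_filter_mul_prod_filter_not Finset.univ (fun i => i < σ i), e,
    ← Finset.prod_mul_distrib]
  exact S.prod_mem fun i _ => h i

/-- The elements of a quadratic algebra that lie in the base ring. -/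
def scalars (a b : ℤ[X]) : Submonoid (QuadraticAlgebra ℤ[X] a b) where
  carrier := {z | z.im = 0}
  one_mem' := rfl
  mul_mem' {y z} hy hz := by
    change y.im = 0 at hy
    change z.im = 0 at hz
    change (y * z).im = 0
    simp [hy, hz]

theorem mem_scalars {a b : ℤ[X]} {z : QuadraticAlgebra ℤ[X] a b} :
    z ∈ scalars a b ↔ z.im = 0 := Iff.rfl

/-! ### Diagrams without odd columns of antiparallel strands -/

/-- The contribution of a column with `a` half-twists, if no columns of antiparallel strands are
odd; in the quadratic algebra, `ε ^ 2 = 0`.  The value `1` is given to the columns that do not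
occur, so that the factors of `a` and `-a` always have a scalar product. -/
noncomputable def mixedFactor (a : ℤ) (par : Bool) : QuadraticAlgebra ℤ[X] 0 0 :=
  if par then ⟨crossCoeff a, 2 * flatCoeff a + X * crossCoeff a⟩
  else if Even a then ⟨-(C (a / 2) * X), 2⟩ else 1

/-- The tangle `A` is encoded by `p + (2 * q) ε`, if `p` and `q` are the coefficients of its skein
expansion, with the correction `X * p` of `2 * q` after an odd number of columns of parallel
strands.  The factor `2` and the correction make the contribution of a column independent of the
columns on its left. -/
def MixedInvariant (o t : Bool) (A : Word) (W : QuadraticAlgebra ℤ[X] 0 0) : Prop :=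
  A.run = some [o, !t, t, !o] ∧ ∃ p q, Expands A (mixedBasis o t) (nestedArcs o t) p q ∧
    W = ⟨p, 2 * q + if t = o then 0 else X * p⟩

theorem MixedInvariant.column {o t : Bool} {A : Word} {W : QuadraticAlgebra ℤ[X] 0 0} (n : ℤ)
    (d : Bool) (h : MixedInvariant o t A W) (hd : ∃ s, Word.run (A ++ column n d) = some s) :
    MixedInvariant o d (A ++ column n d) (W * mixedFactor n (t != d)) := by
  obtain ⟨hA, p, q, hE, rfl⟩ := h
  have hr := run_append_column hA n d
  by_cases htd : d = t
  · subst htd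
    have hn : Even n.natAbs := by
      by_contra hn
      rw [hr] at hd
      simp [hn] at hd
    have hn' : Even n := Int.natAbs_even.1 hn
    refine ⟨by simpa [hn] using hr, _, _, hE.antiparallelColumn hA hn, ?_⟩
    ext1
    · simp [mixedFactor, hn']
      ring
    · simp [mixedFactor, hn']
      split_ifs <;> ring
  · obtain rfl : d = !t := by cases d <;> cases t <;> simp_all
    refine ⟨?_, _, _, hE.parallelColumn hA n, ?_⟩
    · rw [hr]
      cases t <;> simp
    · ext1
      · simp [mixedFactor]
        ring
      · by_cases ht : t = o
        · subst ht
          simp [mixedFactor]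
          ring
        · obtain rfl : o = !t := by cases o <;> cases t <;> simp_all
          simp [mixedFactor]
          ring

theorem mixedFactor_mul_neg (a : ℤ) (par : Bool) :
    mixedFactor a par * mixedFactor (-a) par ∈ scalars 0 0 := by
  rw [mem_scalars]
  cases par
  · by_cases ha : Even a
    · have h2 : -a / 2 = -(a / 2) := by
        obtain ⟨b, rfl⟩ := ha
        omega
      simp [mixedFactor, ha, h2]
      ring
    · simp [mixedFactor, ha, QuadraticAlgebra.im_one]
  · rcases lt_trichotomy a 0 with ha | rfl | ha
    · have h₁ : ¬ 0 < a := by omega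
      have h₂ : 0 < -a := by omega
      simp only [mixedFactor, crossCoeff, flatCoeff, h₁, h₂, Int.natAbs_neg, if_true, if_false,
        QuadraticAlgebra.im_mul, pow_succ]
      ring
    · simp [mixedFactor, crossCoeff, flatCoeff, fibPoly]
    · have h₂ : ¬ 0 < -a := by omega
      simp only [mixedFactor, crossCoeff, flatCoeff, ha, h₂, Int.natAbs_neg, if_true, if_false,
        QuadraticAlgebra.im_mul, pow_succ]
      ring

/-! ### Diagrams that consist of odd columns of antiparallel strands -/

/-- The contribution of a column with `a` half-twists, if all columns are odd and consist of
antiparallel strands; in the quadratic algebra, `ω ^ 2 = 1 - X * ω`.  The value `1` is given to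
the even columns, which do not occur. -/
noncomputable def oddFactor (a : ℤ) (_ : Bool) : QuadraticAlgebra ℤ[X] 1 (-X) :=
  if Even a then 1 else ⟨-(C (a / 2) * X), 1⟩

/-- The tangle `A` is encoded by `p + q ω`, if `p` and `q` are the coefficients of its skein
expansion. -/
def OddInvariant (o t : Bool) (A : Word) (W : QuadraticAlgebra ℤ[X] 1 (-X)) : Prop :=
  t = o ∧ A.run = some [!o, o, o, !o] ∧ Expands A (sideArcs (!o) o) (crossedArcs o o) W.re W.im

theorem OddInvariant.column {o t : Bool} {A : Word} {W : QuadraticAlgebra ℤ[X] 1 (-X)} (n : ℤ)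
    (d : Bool) (h : OddInvariant o t A W) (hd : ∃ s, Word.run (A ++ column n d) = some s) :
    OddInvariant o d (A ++ column n d) (W * oddFactor n (t != d)) := by
  obtain ⟨-, hA, hE⟩ := h
  have hr := run_append_column hA n d
  have hn : ¬ Even n.natAbs := by
    intro hn
    rw [hr] at hd
    simp [hn] at hd
  have hn' : ¬ Even n := mt Int.natAbs_even.2 hn
  obtain rfl : d = o := by
    by_contra hdo
    obtain rfl : d = !o := by cases d <;> cases o <;> simp_all
    rw [hr] at hd
    simp [hn] at hd
  refine ⟨rfl, by simpa [hn] using hr, ?_⟩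
  convert hE.oddColumn hA hn using 1
  · simp [oddFactor, hn']
    ring
  · simp [oddFactor, hn']
    ring

theorem oddFactor_mul_neg (a : ℤ) (par : Bool) :
    oddFactor a par * oddFactor (-a) par ∈ scalars 1 (-X) := by
  rw [mem_scalars]
  by_cases ha : Even a
  · simp [oddFactor, ha, QuadraticAlgebra.im_one]
  · have h2 : -a / 2 = -(a / 2) - 1 := by
      obtain ⟨b, rfl⟩ := Int.not_even_iff_odd.1 ha
      omega
    simp [oddFactor, ha, h2]
    ring

/-! ### Paired columns -/

theorem leftDirection_eq {u : ℕ} (t : ℕ → Bool) {i : ℕ} (hi : i < u) :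
    leftDirection u t i = if i = 0 then t (u - 1) else t (i - 1) := by
  unfold leftDirection
  by_cases h : i = 0
  · rw [if_pos h, h, zero_add, Nat.mod_eq_of_lt (by omega)]
  · have e : i + u - 1 = i - 1 + u := by omega
    rw [if_neg h, e, Nat.add_mod_right, Nat.mod_eq_of_lt (by omega)]

/-- The product of the contributions of all columns is a scalar, if the columns can be paired so
that paired columns have opposite numbers of half-twists and the same label. -/
theorem columnProd_mem_scalars {v : ℕ} {k : Fin (2 * v) → ℤ} {ε : Fin (2 * v) → StrandLabel}
    {σ : Equiv.Perm (Fin (2 * v))} (hσ : IsPairingPermutation k σ) (hσε : ∀ i, ε (σ i) = ε i)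
    {t : ℕ → Bool} (hε : ∀ i : Fin (2 * v),
      ε i = .antiparallel ↔ leftDirection (2 * v) t i ≠ rightDirection t i)
    {a b : ℤ[X]} {f : ℤ → Bool → QuadraticAlgebra ℤ[X] a b}
    (hf : ∀ n par, f n par * f (-n) par ∈ scalars a b) :
    columnProd f (t (2 * v - 1)) (List.ofFn k) t ∈ scalars a b := by
  obtain ⟨hinv, hne, hsum⟩ := hσ
  rw [columnProd_ofFn]
  refine prod_mem_of_involution σ hinv hne _ _ fun i => ?_
  have hpar : ∀ i : Fin (2 * v), ε i = .antiparallel ↔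
      ((if (i : ℕ) = 0 then t (2 * v - 1) else t (i - 1)) != t i) = false := by
    intro i
    rw [hε, leftDirection_eq t i.2, rightDirection]
    cases (if (i : ℕ) = 0 then t (2 * v - 1) else t (i - 1)) <;> cases t i <;> simp
  have hlabel : ((if ((σ i : Fin _) : ℕ) = 0 then t (2 * v - 1) else t (σ i - 1)) != t (σ i)) =
      ((if (i : ℕ) = 0 then t (2 * v - 1) else t (i - 1)) != t i) := by
    rw [Bool.eq_iff_iff, ← not_iff_not, Bool.not_eq_true, Bool.not_eq_true, ← hpar, ← hpar, hσε]
  have hk : k (σ i) = -k i := by linarith [hsum i]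
  rw [hlabel, hk]
  exact hf _ _

end PretzelConway

open PretzelConway

theorem mainTheorem7 (v : ℕ) (k : Fin (2 * v) → ℤ) (ε : Fin (2 * v) → PretzelConway.StrandLabel)
    (D : PretzelConway.Word)
    (hD : PretzelConway.IsOrientedPretzel k ε D)
    (herasable : PretzelConway.Erasable (List.ofFn k))
    (hk : ∀ i, 2 ≤ |k i|)
    (σ : Equiv.Perm (Fin (2 * v)))
    (hσ : PretzelConway.IsPairingPermutation k σ)
    (hσε : ∀ i, ε (σ i) = ε i) :
    PretzelConway.HasConwayPolynomial D 0 := by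
  obtain ⟨hu, -, t, rfl, hD, -, hε⟩ := hD
  obtain ⟨x, hx⟩ := exists_isotopic_sideArcs (List.ofFn k) t hD
  refine HasConwayPolynomial.isotopic hx ?_
  have hlen : (List.ofFn k).length = 2 * v := List.length_ofFn
  have hne : List.ofFn k ≠ [] := by
    intro h
    rw [h, List.length_nil] at hlen
    omega
  have hD' := hx.isLinkDiagram_iff.2 hD
  rw [hlen] at hD' ⊢
  set o := t (2 * v - 1)
  have ht : t ((List.ofFn k).length - 1) = o := by rw [hlen]
  -- The lower end of the first column on the left has direction `x`, its upper end direction `o`.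
  -- They differ exactly if the first column, and then every column, is odd and antiparallel.
  by_cases hxo : x = o
  · subst hxo
    refine hasConwayPolynomial_of_invariant (P := MixedInvariant o) (V := (· ∈ scalars 0 0))
      (fun h => ⟨_, _, _, h.1⟩) (fun n d h hd => h.column n d hd) ?_ _ hne t ht
      (W := 1) (t₀ := o) ?_ hD' ?_
    · rintro A W ⟨-, p, q, hE, rfl⟩ hq
      have hq' : 2 * q = 0 := by simpa [mem_scalars] using hq
      rw [mixedBasis_self] at hE
      refine (hE _ _ _ (hasConwayPolynomial_sideArcs o o)
        (hasConwayPolynomial_nestedArcs o)).congr ?_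
      simpa using hq'
    · refine ⟨run_sideArcs o o, 1, 0, ?_, by
        ext1 <;> simp [QuadraticAlgebra.re_one, QuadraticAlgebra.im_one]⟩
      rw [mixedBasis_self]
      exact .refl _ _
    · rw [one_mul]
      exact columnProd_mem_scalars hσ hσε hε mixedFactor_mul_neg
  · obtain rfl : x = !o := by cases x <;> cases h : o <;> simp_all
    refine hasConwayPolynomial_of_invariant (P := OddInvariant o) (V := (· ∈ scalars 1 (-X)))
      (fun h => ⟨_, _, _, h.2.1⟩) (fun n d h hd => h.column n d hd) ?_ _ hne t ht
      (W := 1) (t₀ := o) ?_ hD' ?_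
    · rintro A W ⟨-, -, hE⟩ hq
      refine (hE _ _ _ (hasConwayPolynomial_sideArcs (!o) o)
        (hasConwayPolynomial_crossedArcs o)).congr ?_
      simpa [mem_scalars] using hq
    · refine ⟨rfl, by simpa using run_sideArcs (!o) o, ?_⟩
      exact .refl _ _
    · rw [one_mul]
      exact columnProd_mem_scalars hσ hσε hε oddFactor_mul_neg
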